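/- For an integer $k$ let $M_k = T_k\cup C\subset S^3$ be the two-component link with the following diagram. Two horizontal strands, a top one and a bottom one, run from left to right through a round circle $C$, which passes over both strands on its left side and under both strands on its right side. To the right of $C$ the two strands are twisted about each other by $|k|$ half-twists (right-handed if $k>0$, left-handed if $k<0$, none if $k=0$). The two left ends and the two right ends are then led downwards, the ends of the top strand on the outside, to a clasp, which consists of two crossings one above the other; at both crossings of the clasp the over-strand runs from south-west to north-east. The two strands and the clasp form one component, the twist knot $T_k$. Orient $M_k$ arbitrarily. A quandle is a set with operations $x\rhd y=x^y$ and $x\rhd^{-1}y=x^{\bar y}$ such that $x\rhd x=x$, $(x\rhd y)\rhd^{-1}y=x=(x\rhd^{-1}y)\rhd y$ and $(x\rhd y)\rhd z=(x\rhd z)\rhd(y\rhd z)$; its components are the orbits of the group generated by the maps $x\mapsto x\rhd y$. The fundamental quandle of an oriented link is generated by the arcs of a diagram, with one relation $x_i=x_k^{x_j}$ for each crossing, where $x_j$ is the over-arc, $x_k$ the under-arc on its right and $x_i$ the under-arc on its left. Let $Q_{(2,3)}(M_k)$ be the fundamental $(2,3)$-quandle of $M_k$, that is, the quotient of the fundamental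 quandle by the relations $(x\rhd y)\rhd y=x$ for all arcs $x$ of $M_k$ and $y$ of $T_k$, and $((x\rhd y)\rhd y)\rhd y=x$ for all arcs $x$ of $M_k$ and $y$ of $C$. Then $$|Q_{(2,3)}(M_k)| = 18\,|2k-1|+8 .$$ More precisely, the component of $Q_{(2,3)}(M_k)$ that contains the arcs of $T_k$ has $18\,|2k-1|$ elements, and the component that contains the arcs of $C$ has $8$ elements. -/

import Mathlib

/-! ### Quandles given by a presentation -/

/-- Terms in the quandle operations `x ▷ y` (`rhd x y`) and `x ▷⁻¹ y` (`rhdInv x y`)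
over a set `X` of generators. -/
inductive QTerm (X : Type) : Type
  | of (x : X) : QTerm X
  | rhd (s t : QTerm X) : QTerm X
  | rhdInv (s t : QTerm X) : QTerm X

/-- The congruence on quandle terms generated by the quandle axioms and the relations `R`. -/
inductive QTerm.Rel {X : Type} (R : QTerm X → QTerm X → Prop) : QTerm X → QTerm X → Prop
  | of {s t} : R s t → Rel R s t
  | refl (s) : Rel R s s
  | symm {s t} : Rel R s t → Rel R t s
  | trans {s t u} : Rel R s t → Rel R t u → Rel R s u
  | rhd_congr {s s' t t'} : Rel R s s' → Rel R t t' → Rel R (rhd s t) (rhd s' t')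
  | rhdInv_congr {s s' t t'} : Rel R s s' → Rel R t t' → Rel R (rhdInv s t) (rhdInv s' t')
  | idem (s) : Rel R (rhd s s) s
  | rhd_rhdInv (s t) : Rel R (rhdInv (rhd s t) t) s
  | rhdInv_rhd (s t) : Rel R (rhd (rhdInv s t) t) s
  | distrib (s t u) : Rel R (rhd (rhd s t) u) (rhd (rhd s u) (rhd t u))

def QTerm.setoid {X : Type} (R : QTerm X → QTerm X → Prop) : Setoid (QTerm X) where
  r := QTerm.Rel R
  iseqv := ⟨QTerm.Rel.refl, QTerm.Rel.symm, QTerm.Rel.trans⟩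

/-- The quandle `⟨X | R⟩`. -/
def PresentedQuandle {X : Type} (R : QTerm X → QTerm X → Prop) : Type :=
  Quotient (QTerm.setoid R)

/-- The class of a term in `⟨X | R⟩`. -/
def PresentedQuandle.mk {X : Type} (R : QTerm X → QTerm X → Prop) (s : QTerm X) :
    PresentedQuandle R :=
  Quotient.mk (QTerm.setoid R) s

/-- Mathlib writes the operator on the left: `y ◃ x` is `x ▷ y`, that is `x ^ y` in exponential
notation. -/
instance {X : Type} (R : QTerm X → QTerm X → Prop) : Quandle (PresentedQuandle R) where
  act y x := Quotient.map₂ (sa := QTerm.setoid R) (sb := QTerm.setoid R) (sc := QTerm.setoid R)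
    QTerm.rhd (fun _ _ h _ _ h' => QTerm.Rel.rhd_congr h h') x y
  invAct y x := Quotient.map₂ (sa := QTerm.setoid R) (sb := QTerm.setoid R) (sc := QTerm.setoid R)
    QTerm.rhdInv (fun _ _ h _ _ h' => QTerm.Rel.rhdInv_congr h h') x y
  self_distrib := by
    rintro ⟨x⟩ ⟨y⟩ ⟨z⟩
    exact Quotient.sound (QTerm.Rel.distrib z y x)
  left_inv := by
    rintro ⟨y⟩ ⟨x⟩
    exact Quotient.sound (QTerm.Rel.rhd_rhdInv x y)
  right_inv := by
    rintro ⟨y⟩ ⟨x⟩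
    exact Quotient.sound (QTerm.Rel.rhdInv_rhd x y)
  fix := by
    rintro ⟨x⟩
    exact Quotient.sound (QTerm.Rel.idem x)

/-- The inner automorphism group: generated by the point symmetries `x ↦ x ▷ y`. -/
def innerGroup (Q : Type) [Quandle Q] : Subgroup (Equiv.Perm Q) :=
  Subgroup.closure (Set.range fun y : Q => Rack.act' y)

/-- The (algebraic) component of `x`: its orbit under the inner automorphism group. -/
def quandleComponent {Q : Type} [Quandle Q] (x : Q) : Set Q :=
  MulAction.orbit (innerGroup Q) x

/-! ### Link diagrams -/

/-- A planar-diagram code. Each crossing has four ends, numbered `0, 1, 2, 3` counterclockwise;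
the ends `i` and `i + 2` belong to the same strand through the crossing. Every edge of the diagram
joins two of these ends. -/
structure PDCode where
  Crossing : Type
  Edge : Type
  /-- the edge attached at the given end of a crossing -/
  edge : Crossing × Fin 4 → Edge
  /-- `true` if the strand through the ends `0, 2` is the over-strand, `false` if the strand
  through the ends `1, 3` is -/
  overEven : Crossing → Bool
  finite : Finite Crossing
  two_ends : ∀ e, ∃ x y, x ≠ y ∧ ∀ z, edge z = e ↔ z = x ∨ z = y

namespace PDCode

/-- The end `i` of the crossing `c` belongs to the over-strand. -/
def IsOver (D : PDCode) (c : D.Crossing) (i : Fin 4) : Prop :=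
  i.val % 2 = 0 ↔ D.overEven c = true

/-- Two edges are consecutive on a strand through a crossing. -/
def Consecutive (D : PDCode) (e f : D.Edge) : Prop :=
  ∃ c i, D.edge (c, i) = e ∧ D.edge (c, i + 2) = f

/-- Two crossings are joined by an edge. -/
def Joined (D : PDCode) (c c' : D.Crossing) : Prop :=
  ∃ i j, D.edge (c, i) = D.edge (c', j)

/-- A pair `(c, i)` also stands for the sector at `c` between the ends `i` and `i + 1`. Two
sectors are neighbours if they lie at the two ends of an edge, on the same side of it; the faces
of the diagram are the classes of the equivalence relation that this generates. -/
def SameSide (D : PDCode) (x y : D.Crossing × Fin 4) : Prop :=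
  (x.1, x.2 + 1) ≠ y ∧ D.edge (x.1, x.2 + 1) = D.edge y

end PDCode

/-- A connected diagram on the sphere of a link with `r` ordered components. As the number of
edges is twice the number of crossings, `planar` is Euler's formula for genus zero. -/
structure LinkDiagram (r : ℕ) extends PDCode where
  connected : ∀ c c', Relation.EqvGen toPDCode.Joined c c'
  planar : Nat.card (Quot toPDCode.SameSide) = Nat.card Crossing + 2
  /-- the link component on which an edge lies -/
  comp : Edge → Fin r
  comp_surjective : Function.Surjective comp
  comp_eq_iff : ∀ e f, comp e = comp f ↔ Relation.EqvGen toPDCode.Consecutive e f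

namespace LinkDiagram

/-- An orientation of the link: `out (c, i) = true` if the edge at the end `i` of the crossing `c`
is directed away from `c` there. -/
structure Orientation {r : ℕ} (D : LinkDiagram r) where
  out : D.Crossing × Fin 4 → Bool
  through : ∀ c i, out (c, i + 2) = !out (c, i)
  along : ∀ x y, x ≠ y → D.edge x = D.edge y → out y = !out x

/-- The Wirtinger relations: the two edges of an over-strand are parts of one arc, and
`z = x ▷ y` where `y` is the over-strand, `x` the under-edge on its right and `z` the
under-edge on its left (as seen along the direction of `y`). -/
inductive WirtingerRel {r : ℕ} (D : LinkDiagram r) (o : D.Orientation) :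
    QTerm D.Edge → QTerm D.Edge → Prop
  | over (c i) (h : D.IsOver c i) :
      WirtingerRel D o (.of (D.edge (c, i))) (.of (D.edge (c, i + 2)))
  | under (c i) (h : D.IsOver c i) (h' : o.out (c, i) = true) :
      WirtingerRel D o (.of (D.edge (c, i + 1)))
        (.rhd (.of (D.edge (c, i + 3))) (.of (D.edge (c, i))))

/-- The Wirtinger relations, together with `x ^ (y ^ n) = x` for all generators `x` and `y`,
where `n = N i` if `y` lies on the `i`-th component of the link. -/
inductive NWirtingerRel {r : ℕ} (D : LinkDiagram r) (o : D.Orientation) (N : Fin r → ℕ) :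
    QTerm D.Edge → QTerm D.Edge → Prop
  | wirtinger {s t} (h : WirtingerRel D o s t) : NWirtingerRel D o N s t
  | power (x y : D.Edge) :
      NWirtingerRel D o N ((fun s => QTerm.rhd s (.of y))^[N (D.comp y)] (.of x)) (.of x)

/-- The fundamental `N`-quandle of the oriented link. -/
abbrev NQuandle {r : ℕ} (D : LinkDiagram r) (o : D.Orientation) (N : Fin r → ℕ) : Type :=
  PresentedQuandle (NWirtingerRel D o N)

/-- The element of the fundamental `N`-quandle given by an edge (a part of an arc). -/
def arc {r : ℕ} (D : LinkDiagram r) (o : D.Orientation) (N : Fin r → ℕ) (e : D.Edge) :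
    D.NQuandle o N :=
  PresentedQuandle.mk _ (.of e)

end LinkDiagram

/-! ### The links `M_k = T_k ∪ C`

Two horizontal strands, top and bottom, pass from left to right through the circle `C` and then
through a block of `|k|` half-twists about a horizontal axis. Outside of this block the two left
ends and the two right ends are led downwards, the top ends outermost, to a clasp. The clasp
consists of two crossings one above the other (a full twist about a vertical axis). -/

namespace TwistLink

/-- `topL`, `botL` (`topR`, `botR`) are the crossings of the left (right) half of `C` with the top
and bottom strand, `twist i` is the `i`-th half-twist from the left, and `claspTop`, `claspBot`
are the upper and the lower crossing of the clasp. -/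
inductive Crossing (m : ℕ) : Type
  | topL | botL | topR | botR | claspTop | claspBot
  | twist (i : Fin m)

/-- `a`, `b`: from the left end of the top and bottom strand to the clasp. `topIn`, `botIn`: the
parts of the two strands inside `C`. `top j`, `bot j`: the parts of the two strands to the right of
`j` half-twists (for `j = m` up to the clasp). `cN`, `cW`, `cS`, `cE`: the four edges of `C`.
`claspL`, `claspR`: the two edges between the crossings of the clasp. -/
inductive Edge (m : ℕ) : Type
  | a | b | topIn | botIn | cN | cW | cS | cE | claspL | claspR
  | top (j : Fin (m + 1))
  | bot (j : Fin (m + 1))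

/-- The edges at a crossing, in the order west, south, east, north for the crossings with `C`, and
in the order north-west, south-west, south-east, north-east for the others. -/
def ends {m : ℕ} : Crossing m → Fin 4 → Edge m
  | .topL => ![.a, .cW, .topIn, .cN]
  | .botL => ![.b, .cS, .botIn, .cW]
  | .topR => ![.topIn, .cE, .top 0, .cN]
  | .botR => ![.botIn, .cS, .bot 0, .cE]
  | .twist i => ![.top i.castSucc, .bot i.castSucc, .bot i.succ, .top i.succ]
  | .claspTop => ![.b, .claspL, .claspR, .bot (Fin.last m)]
  | .claspBot => ![.claspL, .a, .top (Fin.last m), .claspR]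

/-- The left half of `C` is over, the right half under the two strands. In the clasp the strand
from south-west to north-east is over at both crossings. The half-twists are right-handed (the
strand from north-west to south-east is over) if `right = true`, and left-handed otherwise. -/
def overEven {m : ℕ} (right : Bool) : Crossing m → Bool
  | .topL => false
  | .botL => false
  | .topR => true
  | .botR => true
  | .twist _ => right
  | .claspTop => false
  | .claspBot => false

/-- The link component of an edge: `0` is the twist knot, `1` is `C`. -/
def comp {m : ℕ} : Edge m → Fin 2
  | .cN => 1
  | .cW => 1
  | .cS => 1
  | .cE => 1
  | _ => 0

theorem crossing_equiv (m : ℕ) : Nonempty (Crossing m ≃ Fin 6 ⊕ Fin m) :=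
  ⟨{ toFun := fun c => match c with
      | .topL => .inl 0 | .botL => .inl 1 | .topR => .inl 2 | .botR => .inl 3
      | .claspTop => .inl 4 | .claspBot => .inl 5 | .twist i => .inr i
     invFun := fun x => match x with
      | .inl 0 => .topL | .inl 1 => .botL | .inl 2 => .topR | .inl 3 => .botR
      | .inl 4 => .claspTop | .inl 5 => .claspBot | .inr i => .twist i
     left_inv := by intro c; cases c <;> rfl
     right_inv := by
      rintro (i | i)
      · fin_cases i <;> rfl
      · rfl }⟩

/-- Distinguishes the two ends of an edge. -/
def side {m : ℕ} : Crossing m → Fin 4 → Bool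
  | .topL => ![true, true, true, true]
  | .botL => ![true, true, true, false]
  | .topR => ![false, true, true, false]
  | .botR => ![false, false, true, false]
  | .twist _ => ![false, false, true, true]
  | .claspTop => ![false, true, true, false]
  | .claspBot => ![false, false, false, false]

/-- The end of an edge on the given side. -/
def endOf {m : ℕ} : Edge m → Bool → Crossing m × Fin 4
  | .a, s => if s then (.topL, 0) else (.claspBot, 1)
  | .b, s => if s then (.botL, 0) else (.claspTop, 0)
  | .topIn, s => if s then (.topL, 2) else (.topR, 0)
  | .botIn, s => if s then (.botL, 2) else (.botR, 0)
  | .cN, s => if s then (.topL, 3) else (.topR, 3)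
  | .cW, s => if s then (.topL, 1) else (.botL, 3)
  | .cS, s => if s then (.botL, 1) else (.botR, 1)
  | .cE, s => if s then (.topR, 1) else (.botR, 3)
  | .claspL, s => if s then (.claspTop, 1) else (.claspBot, 0)
  | .claspR, s => if s then (.claspTop, 2) else (.claspBot, 3)
  | .top j, true => Fin.cases (.topR, 2) (fun i => (.twist i, 3)) j
  | .top j, false => Fin.lastCases (.claspBot, 2) (fun i => (.twist i, 0)) j
  | .bot j, true => Fin.cases (.botR, 2) (fun i => (.twist i, 2)) j
  | .bot j, false => Fin.lastCases (.claspTop, 3) (fun i => (.twist i, 1)) j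

theorem endOf_ends {m : ℕ} (c : Crossing m) (i : Fin 4) :
    endOf (ends c i) (side c i) = (c, i) := by
  cases c <;> fin_cases i <;> simp [ends, side, endOf]

theorem ends_endOf {m : ℕ} (e : Edge m) (s : Bool) :
    ends (endOf e s).1 (endOf e s).2 = e ∧ side (endOf e s).1 (endOf e s).2 = s := by
  cases e with
  | top j =>
    cases s
    · cases j using Fin.lastCases <;> simp [ends, side, endOf]
    · cases j using Fin.cases <;> simp [ends, side, endOf]
  | bot j =>
    cases s
    · cases j using Fin.lastCases <;> simp [ends, side, endOf]
    · cases j using Fin.cases <;> simp [ends, side, endOf]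
  | _ => cases s <;> simp [ends, side, endOf]

theorem two_ends {m : ℕ} (e : Edge m) : ∃ x y : Crossing m × Fin 4,
    x ≠ y ∧ ∀ z : Crossing m × Fin 4, ends z.1 z.2 = e ↔ z = x ∨ z = y := by
  refine ⟨endOf e true, endOf e false, fun h => ?_, fun z => ⟨?_, ?_⟩⟩
  · have h1 := (ends_endOf e true).2
    rw [h, (ends_endOf e false).2] at h1
    simp at h1
  · rintro rfl
    rcases hs : side z.1 z.2
    · exact .inr (by rw [← hs, endOf_ends])
    · exact .inl (by rw [← hs, endOf_ends])
  · rintro (rfl | rfl)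
    · exact (ends_endOf e _).1
    · exact (ends_endOf e _).1

theorem side_ne {m : ℕ} {c c' : Crossing m} {i j : Fin 4} (h : (c, i) ≠ (c', j))
    (h' : ends c i = ends c' j) : side c' j = !side c i := by
  by_contra hs
  have hs' : side c i = side c' j := by
    revert hs
    cases side c' j <;> cases side c i <;> simp
  exact h (by rw [← endOf_ends c i, ← endOf_ends c' j, h', hs'])

/-- The planar-diagram code of the diagram with `|k|` half-twists, right-handed for `k > 0` and
left-handed for `k < 0`. -/
def code (k : ℤ) : PDCode where
  Crossing := Crossing k.natAbs
  Edge := Edge k.natAbs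
  edge x := ends x.1 x.2
  overEven := overEven (decide (0 < k))
  finite := (crossing_equiv _).elim fun e => Finite.of_equiv _ e.symm
  two_ends := two_ends

theorem connected (k : ℤ) (c c' : (code k).Crossing) :
    Relation.EqvGen (code k).Joined c c' := by
  have step : ∀ (c c' : Crossing k.natAbs) (i j), ends c i = ends c' j →
      Relation.EqvGen (code k).Joined c c' := fun c c' i j h => .rel _ _ ⟨i, j, h⟩
  suffices H : ∀ c : Crossing k.natAbs, Relation.EqvGen (code k).Joined c .topR from
    (H c).trans _ _ _ ((H c').symm _ _)
  have hL : Relation.EqvGen (code k).Joined .topL .topR := step _ _ 2 0 rfl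
  have hB : Relation.EqvGen (code k).Joined .claspBot .topR := (step _ .topL 1 0 rfl).trans _ _ _ hL
  intro c
  cases c with
  | topL => exact hL
  | botL => exact (step _ .topL 3 1 rfl).trans _ _ _ hL
  | topR => exact .refl _
  | botR => exact step _ _ 3 1 rfl
  | claspTop => exact (step _ .claspBot 1 0 rfl).trans _ _ _ hB
  | claspBot => exact hB
  | twist i =>
    obtain ⟨n, hn⟩ := i
    induction n with
    | zero => exact step _ _ 0 2 rfl
    | succ n ih => exact (step _ (.twist ⟨n, by omega⟩) 0 3 rfl).trans _ _ _ (ih (by omega))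

theorem comp_eq_iff (k : ℤ) (e f : (code k).Edge) :
    comp e = comp f ↔ Relation.EqvGen (code k).Consecutive e f := by
  have step : ∀ (c : Crossing k.natAbs) (i : Fin 4),
      Relation.EqvGen (code k).Consecutive (ends c i) (ends c (i + 2)) :=
    fun c i => .rel _ _ ⟨c, i, rfl, rfl⟩
  constructor
  · have hb : Relation.EqvGen (code k).Consecutive .b .a :=
      (step .claspTop 0).trans _ _ _ (step .claspBot 3)
    have ht0 : Relation.EqvGen (code k).Consecutive (.top 0) .a :=
      (step .topR 2).trans _ _ _ (step .topL 2)
    have hb0 : Relation.EqvGen (code k).Consecutive (.bot 0) .a :=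
      ((step .botR 2).trans _ _ _ (step .botL 2)).trans _ _ _ hb
    have htb : ∀ n (hn : n < k.natAbs + 1),
        Relation.EqvGen (code k).Consecutive (.top ⟨n, hn⟩) .a ∧
        Relation.EqvGen (code k).Consecutive (.bot ⟨n, hn⟩) .a := by
      intro n
      induction n with
      | zero => exact fun _ => ⟨ht0, hb0⟩
      | succ n ih =>
        intro hn
        have := ih (by omega)
        exact ⟨(step (.twist ⟨n, by omega⟩) 3).trans _ _ _ this.2,
          (step (.twist ⟨n, by omega⟩) 2).trans _ _ _ this.1⟩
    have h0 : ∀ e : Edge k.natAbs, comp e = 0 → Relation.EqvGen (code k).Consecutive e .a := by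
      intro e he
      cases e with
      | a => exact .refl _
      | b => exact hb
      | topIn => exact step .topL 2
      | botIn => exact (step .botL 2).trans _ _ _ hb
      | claspL => exact (step .claspTop 1).trans _ _ _ (htb _ (Nat.lt_succ_self _)).2
      | claspR => exact step .claspBot 3
      | top j => exact (htb j.1 j.2).1
      | bot j => exact (htb j.1 j.2).2
      | cN => simp [comp] at he
      | cW => simp [comp] at he
      | cS => simp [comp] at he
      | cE => simp [comp] at he
    have h1 : ∀ e : Edge k.natAbs, comp e = 1 → Relation.EqvGen (code k).Consecutive e .cN := by
      intro e he
      cases e with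
      | cN => exact .refl _
      | cW => exact step .topL 1
      | cS => exact (step .botL 1).trans _ _ _ (step .topL 1)
      | cE => exact step .topR 1
      | _ => simp [comp] at he
    intro h
    rcases (show ∀ x : Fin 2, x = 0 ∨ x = 1 by decide) (comp e) with he | he
    · exact (h0 e he).trans _ _ _ ((h0 f (h ▸ he)).symm _ _)
    · exact (h1 e he).trans _ _ _ ((h1 f (h ▸ he)).symm _ _)
  · intro h
    induction h with
    | rel x y h =>
      obtain ⟨c, i, rfl, rfl⟩ := h
      cases c <;> fin_cases i <;> rfl
    | refl => rfl
    | symm _ _ _ ih => exact ih.symm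
    | trans _ _ _ _ _ ih ih' => exact ih.trans ih'

/-- The face to which a sector belongs: `.inr j` lies between the edges `top j` and `bot j`. -/
def face {m : ℕ} : Crossing m → Fin 4 → Fin 7 ⊕ Fin (m + 1)
  | .topL => ![.inl 0, .inl 1, .inl 2, .inl 3]
  | .botL => ![.inl 4, .inl 5, .inl 1, .inl 0]
  | .topR => ![.inl 1, .inr 0, .inl 3, .inl 2]
  | .botR => ![.inl 5, .inl 4, .inr 0, .inl 1]
  | .twist i => ![.inr i.castSucc, .inl 4, .inr i.succ, .inl 3]
  | .claspTop => ![.inl 0, .inl 6, .inr (Fin.last m), .inl 4]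
  | .claspBot => ![.inl 0, .inl 3, .inr (Fin.last m), .inl 6]

/-- The face on the counterclockwise side of the end of `e` on the side `s`. -/
def edgeFace {m : ℕ} : Edge m → Bool → Fin 7 ⊕ Fin (m + 1)
  | .a, s => .inl (if s then 0 else 3)
  | .b, s => .inl (if s then 4 else 0)
  | .topIn, s => .inl (if s then 2 else 1)
  | .botIn, s => .inl (if s then 1 else 5)
  | .cN, s => .inl (if s then 3 else 2)
  | .cW, s => .inl (if s then 1 else 0)
  | .cS, s => .inl (if s then 5 else 4)
  | .cE, s => if s then .inr 0 else .inl 1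
  | .claspL, s => .inl (if s then 6 else 0)
  | .claspR, s => if s then .inr (Fin.last m) else .inl 6
  | .top j, s => if s then .inl 3 else .inr j
  | .bot j, s => if s then .inr j else .inl 4

theorem face_eq {m : ℕ} (c : Crossing m) (i : Fin 4) :
    face c i = edgeFace (ends c i) (side c i) := by
  cases c <;> fin_cases i <;> rfl

theorem face_eq' {m : ℕ} (c : Crossing m) (i : Fin 4) :
    face c i = edgeFace (ends c (i + 1)) (!side c (i + 1)) := by
  cases c <;> fin_cases i <;> rfl

/-- A sector of each face. -/
def sector {m : ℕ} : Fin 7 ⊕ Fin (m + 1) → Crossing m × Fin 4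
  | .inl i => ![(.topL, 0), (.topL, 1), (.topL, 2), (.topR, 2), (.botR, 1), (.botL, 1),
      (.claspTop, 1)] i
  | .inr j => endOf (.top j) false

theorem planar (k : ℤ) : Nat.card (Quot (code k).SameSide) = Nat.card (code k).Crossing + 2 := by
  have hc : Nat.card (code k).Crossing = 6 + k.natAbs := by
    obtain ⟨e⟩ := crossing_equiv k.natAbs
    exact (Nat.card_congr e).trans (by simp)
  let q : Crossing k.natAbs → Fin 4 → Quot (code k).SameSide := fun c i => Quot.mk _ (c, i)
  have wd : ∀ x y : Crossing k.natAbs × Fin 4, (code k).SameSide x y →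
      face x.1 x.2 = face y.1 y.2 := by
    rintro ⟨c, i⟩ ⟨c', j⟩ ⟨h, h'⟩
    change ends c (i + 1) = ends c' j at h'
    rw [face_eq', face_eq, ← side_ne h h', h']
  have step : ∀ (c : Crossing k.natAbs) (i : Fin 4),
      q c i = Quot.mk _ (endOf (ends c (i + 1)) (!side c (i + 1))) := by
    intro c i
    have h := ends_endOf (ends c (i + 1)) (!side c (i + 1))
    refine Quot.sound ⟨fun h' => ?_, h.1.symm⟩
    have h2 := h.2
    rw [← h'] at h2
    simp at h2
  have htop : ∀ j, Quot.mk (code k).SameSide (endOf (.top j) true) = q .topR 2 := by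
    intro j
    induction j using Fin.induction with
    | zero => rfl
    | succ i ih => exact (step (.twist i) 3).trans ih
  have hbot : ∀ j, Quot.mk (code k).SameSide (endOf (.bot j) false) = q .botR 1 := by
    intro j
    induction j using Fin.induction with
    | zero => exact (step .botR 1).symm
    | succ i ih =>
      refine (step (.twist i) 1).symm.trans (Eq.trans ?_ ih)
      simp [q, endOf]
      rfl
  have hb3 : q .claspTop 3 = q .botR 1 := by
    rw [← hbot (Fin.last _)]
    simp [q, endOf]
    rfl
  have hl : q .claspBot 2 = Quot.mk _ (endOf (.top (Fin.last _)) false) := by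
    simp [q, endOf]
    rfl
  have e : Quot (code k).SameSide ≃ Fin 7 ⊕ Fin (k.natAbs + 1) :=
    { toFun := Quot.lift (fun x => face x.1 x.2) wd
      invFun := fun f => Quot.mk _ (sector f)
      left_inv := by
        rintro ⟨c, i⟩
        change Quot.mk _ (sector (face c i)) = q c i
        symm
        have b3 : q .botL 3 = q .topL 0 := (step .topL 0).symm
        have c0 : q .claspTop 0 = q .topL 0 := (step .botL 3).symm.trans b3
        have t0 : q .topR 0 = q .topL 1 := (step .topL 1).symm
        have r3 : q .botR 3 = q .topL 1 := (step .topR 0).symm.trans t0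
        cases c with
        | topL =>
          fin_cases i
          · rfl
          · rfl
          · rfl
          · exact (step .topR 2).symm
        | botL =>
          fin_cases i
          · exact step .botL 0
          · rfl
          · exact step .botL 2
          · exact b3
        | topR =>
          fin_cases i
          · exact t0
          · exact step .topR 1
          · rfl
          · exact step .topR 3
        | botR =>
          fin_cases i
          · exact (step .botL 1).symm
          · rfl
          · exact (step .botR 2).trans (step .topR 1)
          · exact r3
        | claspTop =>
          fin_cases i
          · exact c0
          · rfl
          · exact (step .claspBot 2).symm.trans hl
          · exact hb3
        | claspBot =>
          fin_cases i
          · exact (step .claspTop 0).symm.trans c0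
          · exact (step .claspBot 1).trans (htop _)
          · exact hl
          · exact (step .claspTop 1).symm
        | twist i' =>
          fin_cases i
          · simp [q, face, sector, endOf]
            rfl
          · exact (congrArg (Quot.mk _) (by simp [endOf]; rfl)).trans (hbot i'.castSucc)
          · exact step (.twist i') 2
          · exact htop i'.succ
      right_inv := by
        rintro (i | j)
        · fin_cases i <;> rfl
        · change face (endOf (.top j) false).1 (endOf (.top j) false).2 = _
          rw [face_eq, (ends_endOf _ _).1, (ends_endOf _ _).2]
          rfl }
  rw [hc, Nat.card_congr e]
  simp
  omega

/-- An orientation: `true` if the edge is directed from its end on the side `true` to the other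
one. -/
def direction {m : ℕ} : Edge m → Bool
  | .a => true
  | .b => false
  | .topIn => false
  | .botIn => true
  | .cN => false
  | .cW => true
  | .cS => true
  | .cE => false
  | .claspL => decide (m % 2 = 0)
  | .claspR => false
  | .top j => decide (j.val % 2 = 1)
  | .bot j => decide (j.val % 2 = 0)

end TwistLink

/-- The link `M_k = T_k ∪ C` for an integer `k`, with the twist knot `T_k` as its first and `C` as
its second component. -/
def twistLink (k : ℤ) : LinkDiagram 2 where
  toPDCode := TwistLink.code k
  connected := TwistLink.connected k
  planar := TwistLink.planar k
  comp := TwistLink.comp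
  comp_surjective := by
    intro i
    fin_cases i
    · exact ⟨TwistLink.Edge.a, rfl⟩
    · exact ⟨TwistLink.Edge.cN, rfl⟩
  comp_eq_iff := TwistLink.comp_eq_iff k

theorem twistLink_orientation_nonempty (k : ℤ) : Nonempty (twistLink k).Orientation := by
  refine ⟨⟨fun x => !xor (TwistLink.side x.1 x.2) (TwistLink.direction (TwistLink.ends x.1 x.2)),
    ?_, ?_⟩⟩
  · intro c i
    rcases c with _ | _ | _ | _ | _ | _ | j <;> fin_cases i <;>
      simp [TwistLink.side, TwistLink.ends, TwistLink.direction] <;> grind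
  · rintro ⟨c, i⟩ ⟨c', j⟩ h h'
    change TwistLink.ends c i = TwistLink.ends c' j at h'
    have := TwistLink.side_ne h h'
    simp [this, h']

/-! ### Inner automorphisms and presentations -/

/-! Let x, y be the two strands inside the circle and c an arc of it. Let X, Y be the symmetries at
x, y, put R = XY (`symmProd`), and let Z be the symmetry at c or its inverse, whichever carries the
strands inside C to those on its left. Then X² = Y² = Z³ = 1 and X inverts R. Going once round C
shows that R fixes c, hence commutes with Z. The arcs of the twist region are terms d_s of one
dihedral sequence (`dihedralSeq`), shifted by one at each half-twist.

Upper bound. Put n = 2k - 1. The clasp makes X act on the levels d_s, Z d_s, Z⁻¹ d_s by the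
reflections s ↦ -s, n - s, -n - s (`reflection_zpow_one`, `reflection_zpow_neg_one`) and gives
XZXZ⁻¹X = ZXZ⁻¹Rⁿ (`clasp_relation`). On Z⁻¹ d_s this relation yields d_{s+6n} = d_s, so at most 3 ·
6|n| elements Z^j d_s remain. On the orbit of c, where R is trivial, it leaves at most 8 elements.
Since X, R, Z generate the inner group, these two lists are the two components.

Lower bound. The quandle maps to the conjugation quandle of SL(2,3) × D, where D is dihedral of
order 6|n|: d_s goes to (q^{1+2s}, reflection s), and Z becomes conjugation by (t, rotation by n),
with q of order 4 and t of order 3. The first factor detects j and s mod 2 and the second s mod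
3|n|; as 3|n| is odd, s is detected mod 6|n|. On the circle component the four conjugates of t and
the two rotations by ±n give 8 distinct values (`element_injective`). -/

theorem perm_apply_inv {α : Type} (p : Equiv.Perm α) (a : α) : p (p⁻¹ a) = a :=
  p.apply_symm_apply a

theorem perm_inv_apply {α : Type} (p : Equiv.Perm α) (a : α) : p⁻¹ (p a) = a :=
  p.symm_apply_apply a

section Inner

variable {Q : Type} [Quandle Q]

theorem act'_mem_innerGroup (q : Q) : Rack.act' q ∈ innerGroup Q :=
  Subgroup.subset_closure ⟨q, rfl⟩

theorem act'_self (q : Q) : Rack.act' q q = q := by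
  rw [Rack.act'_apply, Quandle.fix]

theorem act'_inv_self (q : Q) : (Rack.act' q)⁻¹ q = q := by
  rw [Equiv.Perm.inv_eq_iff_eq, act'_self]

/-- Point symmetries are quandle automorphisms, so every inner automorphism transports the symmetry
at a point by conjugation. -/
theorem act'_inner {p : Equiv.Perm Q} (hp : p ∈ innerGroup Q) (q : Q) :
    Rack.act' (p q) = p * Rack.act' q * p⁻¹ := by
  induction hp using Subgroup.closure_induction generalizing q with
  | mem p hp =>
    obtain ⟨y, rfl⟩ := hp
    exact Rack.ad_conj y q
  | one => simp
  | mul p p' _ _ ih ih' => rw [Equiv.Perm.mul_apply, ih, ih', mul_inv_rev]; simp only [mul_assoc]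
  | inv p _ ih =>
    have h := ih (p⁻¹ q)
    rw [perm_apply_inv] at h
    rw [h]
    group

theorem mem_quandleComponent_iff {a b : Q} :
    b ∈ quandleComponent a ↔ ∃ p ∈ innerGroup Q, p a = b := by
  constructor
  · rintro ⟨⟨p, hp⟩, rfl⟩
    exact ⟨p, hp, rfl⟩
  · rintro ⟨p, hp, rfl⟩
    exact ⟨⟨p, hp⟩, rfl⟩

theorem quandleComponent_eq_of_mem {a b : Q} (h : b ∈ quandleComponent a) :
    quandleComponent b = quandleComponent a :=
  MulAction.orbit_eq_iff.2 h

end Inner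

/-! ### Inner automorphisms of presented quandles and maps to conjugation quandles. -/

namespace PresentedQuandle

variable {X : Type} {R : QTerm X → QTerm X → Prop}

theorem mk_rhd (s t : QTerm X) : mk R (.rhd s t) = Rack.act' (mk R t) (mk R s) := rfl

theorem mk_rhdInv (s t : QTerm X) : mk R (.rhdInv s t) = (Rack.act' (mk R t))⁻¹ (mk R s) := rfl

theorem act'_mem_of_generators {H : Subgroup (Equiv.Perm (PresentedQuandle R))}
    (h : ∀ x, Rack.act' (mk R (.of x)) ∈ H) (q : PresentedQuandle R) : Rack.act' q ∈ H := by
  obtain ⟨t, rfl⟩ : ∃ t, mk R t = q := Quotient.exists_rep q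
  induction t with
  | of x => exact h x
  | rhd s t ihs iht =>
    rw [mk_rhd, act'_inner (act'_mem_innerGroup _)]
    exact H.mul_mem (H.mul_mem iht ihs) (H.inv_mem iht)
  | rhdInv s t ihs iht =>
    rw [mk_rhdInv, act'_inner (inv_mem (act'_mem_innerGroup _))]
    exact H.mul_mem (H.mul_mem (H.inv_mem iht) ihs) (H.inv_mem (H.inv_mem iht))

theorem innerGroup_le_of_generators {H : Subgroup (Equiv.Perm (PresentedQuandle R))}
    (h : ∀ x, Rack.act' (mk R (.of x)) ∈ H) : innerGroup (PresentedQuandle R) ≤ H := by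
  refine (Subgroup.closure_le H).2 ?_
  rintro _ ⟨q, rfl⟩
  exact act'_mem_of_generators h q

theorem exists_inner_generator (q : PresentedQuandle R) :
    ∃ p ∈ innerGroup (PresentedQuandle R), ∃ x, p (mk R (.of x)) = q := by
  obtain ⟨t, rfl⟩ : ∃ t, mk R t = q := Quotient.exists_rep q
  induction t with
  | of x => exact ⟨1, one_mem _, x, rfl⟩
  | rhd s t ihs iht =>
    obtain ⟨p, hp, x, hx⟩ := ihs
    exact ⟨_ * p, mul_mem (act'_mem_innerGroup (mk R t)) hp, x, by
      rw [mk_rhd, Equiv.Perm.mul_apply, hx]⟩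
  | rhdInv s t ihs iht =>
    obtain ⟨p, hp, x, hx⟩ := ihs
    exact ⟨_ * p, mul_mem (inv_mem (act'_mem_innerGroup (mk R t))) hp, x, by
      rw [mk_rhdInv, Equiv.Perm.mul_apply, hx]⟩

/-- An inner automorphism respects both operations, so it is determined by its values on generators.
-/
theorem inner_eq_one {p : Equiv.Perm (PresentedQuandle R)}
    (hp : p ∈ innerGroup (PresentedQuandle R)) (h : ∀ x, p (mk R (.of x)) = mk R (.of x)) :
    p = 1 := by
  ext q
  obtain ⟨t, rfl⟩ : ∃ t, mk R t = q := Quotient.exists_rep q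
  rw [Equiv.Perm.one_apply]
  induction t with
  | of x => exact h x
  | rhd s t ihs iht =>
    have hc := act'_inner hp (mk R t)
    rw [iht, eq_mul_inv_iff_mul_eq] at hc
    rw [mk_rhd, ← Equiv.Perm.mul_apply, ← hc, Equiv.Perm.mul_apply, ihs]
  | rhdInv s t ihs iht =>
    have hc := act'_inner hp (mk R t)
    rw [iht, eq_mul_inv_iff_mul_eq] at hc
    rw [mk_rhdInv, Equiv.Perm.eq_inv_iff_eq, ← Equiv.Perm.mul_apply, hc, Equiv.Perm.mul_apply,
      perm_apply_inv, ihs]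

/-- The value of a quandle term in the conjugation quandle of a group. -/
def evalConj {G : Type} [Group G] (f : X → G) : QTerm X → G
  | .of x => f x
  | .rhd s t => evalConj f t * evalConj f s * (evalConj f t)⁻¹
  | .rhdInv s t => (evalConj f t)⁻¹ * evalConj f s * evalConj f t

theorem evalConj_eq {G : Type} [Group G] {f : X → G}
    (h : ∀ s t, R s t → evalConj f s = evalConj f t) {s t : QTerm X} (hst : QTerm.Rel R s t) :
    evalConj f s = evalConj f t := by
  induction hst with
  | of hst => exact h _ _ hst
  | refl => rfl
  | symm _ ih => exact ih.symm
  | trans _ _ ih ih' => exact ih.trans ih'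
  | rhd_congr _ _ ih ih' => simp only [evalConj, ih, ih']
  | rhdInv_congr _ _ ih ih' => simp only [evalConj, ih, ih']
  | idem | rhd_rhdInv | rhdInv_rhd | distrib => simp only [evalConj]; group

theorem evalConj_iterate_rhd {G : Type} [Group G] (f : X → G) (y : X) (m : ℕ) (s : QTerm X) :
    evalConj f ((fun s => QTerm.rhd s (.of y))^[m] s) = f y ^ m * evalConj f s * (f y ^ m)⁻¹ := by
  induction m generalizing s with
  | zero => simp
  | succ m ih =>
    rw [Function.iterate_succ_apply, ih, evalConj, evalConj, pow_succ]
    group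

/-- The map to the conjugation quandle of a group given by images of the generators that satisfy
the relations. -/
def liftConj {G : Type} [Group G] (f : X → G)
    (h : ∀ s t, R s t → evalConj f s = evalConj f t) : PresentedQuandle R → G :=
  Quotient.lift (evalConj f) fun _ _ hst => evalConj_eq h hst

theorem liftConj_act' {G : Type} [Group G] (f : X → G)
    (h : ∀ s t, R s t → evalConj f s = evalConj f t) (a b : PresentedQuandle R) :
    liftConj f h (Rack.act' a b) = liftConj f h a * liftConj f h b * (liftConj f h a)⁻¹ := by
  obtain ⟨s, rfl⟩ : ∃ s, mk R s = a := Quotient.exists_rep a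
  obtain ⟨t, rfl⟩ : ∃ t, mk R t = b := Quotient.exists_rep b
  rfl

end PresentedQuandle

/-- The pairs of a permutation `p` of `Q` and a group element `g` such that `φ` intertwines `p`
with the conjugation by `g`. -/
def intertwiners {Q G : Type} [Group G] (φ : Q → G) : Subgroup (Equiv.Perm Q × G) where
  carrier := {u | ∀ q, φ (u.1 q) = u.2 * φ q * u.2⁻¹}
  one_mem' q := by simp
  mul_mem' {u v} hu hv q := by
    change φ (u.1 (v.1 q)) = _
    rw [hu, hv, Prod.snd_mul, mul_inv_rev]
    simp only [mul_assoc]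
  inv_mem' {u} hu q := by
    have h := hu (u.1⁻¹ q)
    rw [perm_apply_inv] at h
    rw [Prod.fst_inv, Prod.snd_inv, h]
    group

theorem mem_intertwiners_iff {Q G : Type} [Group G] {φ : Q → G} {p : Equiv.Perm Q} {g : G} :
    (p, g) ∈ intertwiners φ ↔ ∀ q, φ (p q) = g * φ q * g⁻¹ := Iff.rfl

/-! ### Quandles with the relations of the links `M_k` -/

section TwistRelations

open Rack (act')

variable {Q : Type} [Quandle Q]

/-- The product of the point symmetries at `x` and `y`. -/
def symmProd (x y : Q) : Equiv.Perm Q := act' x * act' y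

/-- For involutive `x` and `y`, the bi-infinite sequence with `dihedralSeq x y 0 = x` and
`dihedralSeq x y 1 = y` in which the symmetry at each term exchanges its two neighbours. -/
def dihedralSeq (x y : Q) (i : ℤ) : Q :=
  (symmProd x y ^ (-(i / 2))) (if i % 2 = 0 then x else y)

theorem dihedralSeq_even (x y : Q) (t : ℤ) :
    dihedralSeq x y (2 * t) = (symmProd x y ^ (-t)) x := by
  rw [dihedralSeq, if_pos (by omega), show 2 * t / 2 = t by omega]

theorem dihedralSeq_odd (x y : Q) (t : ℤ) :
    dihedralSeq x y (2 * t + 1) = (symmProd x y ^ (-t)) y := by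
  rw [dihedralSeq, if_neg (by omega), show (2 * t + 1) / 2 = t by omega]

theorem dihedralSeq_zero (x y : Q) : dihedralSeq x y 0 = x := by
  simpa using dihedralSeq_even x y 0

theorem dihedralSeq_one (x y : Q) : dihedralSeq x y 1 = y := by
  simpa using dihedralSeq_odd x y 0

theorem symmProd_zpow_dihedralSeq (x y : Q) (j i : ℤ) :
    (symmProd x y ^ j) (dihedralSeq x y i) = dihedralSeq x y (i - 2 * j) := by
  rcases Int.even_or_odd' i with ⟨t, rfl | rfl⟩
  · rw [show 2 * t - 2 * j = 2 * (t - j) by ring, dihedralSeq_even, dihedralSeq_even,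
      ← Equiv.Perm.mul_apply, ← zpow_add]
    congr 2; ring
  · rw [show 2 * t + 1 - 2 * j = 2 * (t - j) + 1 by ring, dihedralSeq_odd, dihedralSeq_odd,
      ← Equiv.Perm.mul_apply, ← zpow_add]
    congr 2; ring

theorem act'_mul_symmProd {x y : Q} (hx : act' x * act' x = 1) (hy : act' y * act' y = 1) :
    SemiconjBy (act' x) (symmProd x y) (symmProd x y)⁻¹ := by
  have hx' : (act' x)⁻¹ = act' x := inv_eq_of_mul_eq_one_right hx
  have hy' : (act' y)⁻¹ = act' y := inv_eq_of_mul_eq_one_right hy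
  rw [SemiconjBy, symmProd, mul_inv_rev, hx', hy', ← mul_assoc, hx, mul_assoc, hx]
  simp

theorem act'_mul_symmProd_zpow {x y : Q} (hx : act' x * act' x = 1) (hy : act' y * act' y = 1)
    (i : ℤ) : act' x * symmProd x y ^ i = symmProd x y ^ (-i) * act' x := by
  have h := (act'_mul_symmProd hx hy).zpow_right i
  rw [inv_zpow'] at h
  exact h

theorem symmProd_mem_innerGroup (x y : Q) : symmProd x y ∈ innerGroup Q :=
  mul_mem (act'_mem_innerGroup x) (act'_mem_innerGroup y)

/-- The terms are translates of `x` and `y` by powers of R, and X inverts R: for example R^{-t} X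
R^t = X R^{2t}. -/
theorem act'_dihedralSeq {x y : Q} (hx : act' x * act' x = 1) (hy : act' y * act' y = 1) (i : ℤ) :
    act' (dihedralSeq x y i) = act' x * symmProd x y ^ i := by
  have hR := symmProd_mem_innerGroup x y
  rcases Int.even_or_odd' i with ⟨t, rfl | rfl⟩
  · rw [dihedralSeq_even, act'_inner (zpow_mem hR _), ← act'_mul_symmProd_zpow hx hy,
      zpow_neg, inv_inv, mul_assoc, ← zpow_add, two_mul]
  · have hy' : act' y = act' x * symmProd x y := by rw [symmProd, ← mul_assoc, hx, one_mul]
    rw [dihedralSeq_odd, act'_inner (zpow_mem hR _), hy', ← mul_assoc,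
      ← act'_mul_symmProd_zpow hx hy, zpow_neg, inv_inv, mul_assoc, mul_assoc, ← zpow_one_add,
      ← zpow_add]
    congr 2; ring

theorem act'_apply_dihedralSeq {x y : Q} (hx : act' x * act' x = 1) (hy : act' y * act' y = 1)
    (i : ℤ) : act' x (dihedralSeq x y i) = dihedralSeq x y (-i) := by
  rcases Int.even_or_odd' i with ⟨t, rfl | rfl⟩
  · rw [dihedralSeq_even, ← Equiv.Perm.mul_apply, act'_mul_symmProd_zpow hx hy,
      Equiv.Perm.mul_apply, act'_self, show -(2 * t) = 2 * (-t) by ring, dihedralSeq_even]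
  · have hxy : act' x y = symmProd x y y := by
      rw [symmProd, Equiv.Perm.mul_apply, act'_self]
    rw [dihedralSeq_odd, ← Equiv.Perm.mul_apply, act'_mul_symmProd_zpow hx hy,
      Equiv.Perm.mul_apply, hxy, ← Equiv.Perm.mul_apply, ← zpow_add_one,
      show -(2 * t + 1) = 2 * (-t - 1) + 1 by ring, dihedralSeq_odd]
    congr 2; ring

theorem act'_dihedralSeq_apply {x y : Q} (hx : act' x * act' x = 1) (hy : act' y * act' y = 1)
    (i j : ℤ) :
    act' (dihedralSeq x y i) (dihedralSeq x y j) = dihedralSeq x y (2 * i - j) := by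
  rw [act'_dihedralSeq hx hy, Equiv.Perm.mul_apply, symmProd_zpow_dihedralSeq,
    act'_apply_dihedralSeq hx hy]
  congr 1; ring

/-- The relations between the strands `x` and `y` inside the circle and the arc `c` of the circle;
`Z` is the symmetry at `c` or its inverse, according to the orientation of the circle. -/
structure TwistRelations (k : ℤ) (x y c : Q) (Z : Equiv.Perm Q) : Prop where
  hx : act' x * act' x = 1
  hy : act' y * act' y = 1
  pow_three : Z ^ 3 = 1
  circle : Z = act' c ∨ Z = (act' c)⁻¹
  symmProd_circle : symmProd x y c = c
  clasp_top : Z x = act' (dihedralSeq x y (1 - k)) (Z y)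
  clasp_bot : dihedralSeq x y (-k) = act' (Z x) (dihedralSeq x y (1 - k))

namespace TwistRelations

variable {k : ℤ} {x y c : Q} {Z : Equiv.Perm Q}

theorem mem_innerGroup (h : TwistRelations k x y c Z) : Z ∈ innerGroup Q := by
  rcases h.circle with rfl | rfl
  · exact act'_mem_innerGroup c
  · exact inv_mem (act'_mem_innerGroup c)

theorem apply_circle (h : TwistRelations k x y c Z) : Z c = c := by
  rcases h.circle with rfl | rfl
  · exact act'_self c
  · exact act'_inv_self c

/-- R is an inner automorphism fixing c, so conjugation by R fixes the symmetry at c. -/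
theorem commute (h : TwistRelations k x y c Z) : Commute Z (symmProd x y) := by
  have hc : Commute (act' c) (symmProd x y) := by
    have h' := act'_inner (symmProd_mem_innerGroup x y) c
    rw [h.symmProd_circle, eq_mul_inv_iff_mul_eq] at h'
    exact h'
  rcases h.circle with rfl | rfl
  · exact hc
  · exact hc.inv_left

/-! ### The clasp relations and the periodicity of the dihedral sequence. -/

theorem act'_act' (h : TwistRelations k x y c Z) (q : Q) : act' x (act' x q) = q := by
  rw [← Equiv.Perm.mul_apply, h.hx, Equiv.Perm.one_apply]

theorem act'_zpow_symmProd (h : TwistRelations k x y c Z) (i : ℤ) (q : Q) :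
    act' x ((symmProd x y ^ i) q) = (symmProd x y ^ (-i)) (act' x q) := by
  rw [← Equiv.Perm.mul_apply, act'_mul_symmProd_zpow h.hx h.hy, Equiv.Perm.mul_apply]

theorem zpow_zpow_symmProd (h : TwistRelations k x y c Z) (j i : ℤ) (q : Q) :
    (Z ^ j) ((symmProd x y ^ i) q) = (symmProd x y ^ i) ((Z ^ j) q) := by
  rw [← Equiv.Perm.mul_apply, ((h.commute.zpow_right i).zpow_left j).eq, Equiv.Perm.mul_apply]

/-- One value determines the whole reflection: R shifts the index by -2, commutes with Z and is
inverted by X, which settles the indices of the parity of `a`. As X is an involution it also sends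
the term at `b` to that at `a`, and `b` has the other parity. -/
theorem reflection_of_eq (h : TwistRelations k x y c Z) {j a b : ℤ} (hab : (a - b) % 2 = 1)
    (h₀ : act' x ((Z ^ j) (dihedralSeq x y a)) = (Z ^ j) (dihedralSeq x y b)) (s : ℤ) :
    act' x ((Z ^ j) (dihedralSeq x y s)) = (Z ^ j) (dihedralSeq x y (a + b - s)) := by
  have h₁ : act' x ((Z ^ j) (dihedralSeq x y b)) = (Z ^ j) (dihedralSeq x y a) := by
    rw [← h₀, h.act'_act']
  have key : ∀ u v t : ℤ,
      act' x ((Z ^ j) (dihedralSeq x y u)) = (Z ^ j) (dihedralSeq x y v) →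
      act' x ((Z ^ j) (dihedralSeq x y (u - 2 * t))) =
        (Z ^ j) (dihedralSeq x y (v + 2 * t)) := by
    intro u v t huv
    rw [← symmProd_zpow_dihedralSeq, h.zpow_zpow_symmProd, h.act'_zpow_symmProd, huv,
      ← h.zpow_zpow_symmProd, symmProd_zpow_dihedralSeq]
    congr 2; ring
  rcases Int.even_or_odd' (a - s) with ⟨t, ht | ht⟩
  · rw [show s = a - 2 * t by omega, key a b t h₀]
    congr 2; ring
  · obtain ⟨t', ht'⟩ : ∃ t', b - s = 2 * t' := ⟨(b - s) / 2, by omega⟩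
    rw [show s = b - 2 * t' by omega, key b a t' h₁]
    congr 2; ring

theorem reflection_zpow_one (h : TwistRelations k x y c Z) (s : ℤ) :
    act' x (Z (dihedralSeq x y s)) = Z (dihedralSeq x y (2 * k - 1 - s)) := by
  -- The upper clasp crossing reads Zx = X R^{1-k} Zy, hence XZx = Z R^{1-k} d_1 = Z d_{2k-1}.
  have h₀ : act' x ((Z ^ (1 : ℤ)) (dihedralSeq x y 0)) =
      (Z ^ (1 : ℤ)) (dihedralSeq x y (2 * k - 1)) := by
    have h' := h.clasp_top
    rw [act'_dihedralSeq h.hx h.hy, Equiv.Perm.mul_apply] at h'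
    rw [dihedralSeq_zero, zpow_one, h', h.act'_act', ← zpow_one Z, ← h.zpow_zpow_symmProd]
    have h₂ := symmProd_zpow_dihedralSeq x y (1 - k) 1
    rw [dihedralSeq_one] at h₂
    rw [h₂]
    congr 2; ring
  simpa using h.reflection_of_eq (by omega) h₀ s

theorem reflection_zpow_neg_one (h : TwistRelations k x y c Z) (s : ℤ) :
    act' x (Z⁻¹ (dihedralSeq x y s)) = Z⁻¹ (dihedralSeq x y (1 - 2 * k - s)) := by
  -- The lower clasp crossing has over-arc Zx, whose symmetry is ZXZ⁻¹; apply Z⁻¹ to both sides.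
  have h₀ : act' x ((Z ^ (-1 : ℤ)) (dihedralSeq x y (1 - k))) =
      (Z ^ (-1 : ℤ)) (dihedralSeq x y (-k)) := by
    rw [h.clasp_bot, act'_inner h.mem_innerGroup, zpow_neg_one, Equiv.Perm.mul_apply,
      Equiv.Perm.mul_apply, perm_inv_apply]
  have h₁ := h.reflection_of_eq (by omega) h₀ s
  rw [zpow_neg_one] at h₁
  rw [h₁]
  congr 2; ring

/-- Comparison of the symmetries at the two equal points X Z d_0 and Z d_{2k-1}. -/
theorem clasp_relation (h : TwistRelations k x y c Z) :
    act' x * (Z * act' x * Z⁻¹) * act' x = Z * act' x * Z⁻¹ * symmProd x y ^ (2 * k - 1) := by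
  have hx' : (act' x)⁻¹ = act' x := inv_eq_of_mul_eq_one_right h.hx
  have h₁ := congrArg act' (h.reflection_zpow_one 0)
  rw [act'_inner (act'_mem_innerGroup x), act'_inner h.mem_innerGroup,
    act'_inner h.mem_innerGroup, act'_dihedralSeq h.hx h.hy, act'_dihedralSeq h.hx h.hy,
    zpow_zero, mul_one, sub_zero, hx'] at h₁
  rw [h₁, mul_assoc, mul_assoc, mul_assoc, mul_assoc,
    (h.commute.inv_left.zpow_right _).eq]

theorem sq_eq_inv (h : TwistRelations k x y c Z) : Z⁻¹ = Z * Z := by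
  refine inv_eq_of_mul_eq_one_right ?_
  rw [← h.pow_three]; group; rfl

theorem inv_inv_apply (h : TwistRelations k x y c Z) (q : Q) : Z⁻¹ (Z⁻¹ q) = Z q := by
  rw [Equiv.Perm.inv_eq_iff_eq, h.sq_eq_inv, Equiv.Perm.mul_apply]

theorem apply_apply (h : TwistRelations k x y c Z) (q : Q) : Z (Z q) = Z⁻¹ q := by
  rw [h.sq_eq_inv, Equiv.Perm.mul_apply]

theorem clasp_relation_apply (h : TwistRelations k x y c Z) (q : Q) :
    act' x (Z (act' x (Z⁻¹ (act' x q)))) =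
      Z (act' x (Z⁻¹ ((symmProd x y ^ (2 * k - 1)) q))) :=
  congrArg (fun p : Equiv.Perm Q => p q) h.clasp_relation

theorem dihedralSeq_add (h : TwistRelations k x y c Z) (s : ℤ) :
    dihedralSeq x y (s + 6 * (2 * k - 1)) = dihedralSeq x y s := by
  -- With n = 2k - 1, the clasp relation at Z⁻¹ d_t reduces by the two reflections and Z³ = 1 to
  -- d_{-3n-t} = d_{3n-t}; the choice t = -3n - s makes this d_s = d_{s+6n}.
  have h₁ := h.clasp_relation_apply (Z⁻¹ (dihedralSeq x y (-3 * (2 * k - 1) - s)))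
  have h₂ : ∀ i s, (symmProd x y ^ i) (Z⁻¹ (dihedralSeq x y s)) =
      Z⁻¹ (dihedralSeq x y (s - 2 * i)) := by
    intro i s
    rw [← zpow_neg_one, ← h.zpow_zpow_symmProd, symmProd_zpow_dihedralSeq]
  rw [h₂, h.inv_inv_apply, h.reflection_zpow_one, h.reflection_zpow_neg_one, h.inv_inv_apply,
    h.reflection_zpow_one, h.apply_apply, h.apply_apply, h.reflection_zpow_neg_one] at h₁
  have h₃ := Z⁻¹.injective h₁
  rw [show s = 1 - 2 * k - (2 * k - 1 - (1 - 2 * k - (-3 * (2 * k - 1) - s))) by ring, h₃]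
  congr 1; ring

theorem dihedralSeq_add_mul (h : TwistRelations k x y c Z) (s t : ℤ) :
    dihedralSeq x y (s + 6 * (2 * k - 1) * t) = dihedralSeq x y s := by
  induction t using Int.induction_on with
  | zero => simp
  | succ t ih =>
    rw [← ih, ← h.dihedralSeq_add (s + 6 * (2 * k - 1) * t)]
    congr 1; ring
  | pred t ih =>
    rw [← ih, ← h.dihedralSeq_add (s + 6 * (2 * k - 1) * (-t - 1))]
    congr 1; ring

/-- The elements of the component of the twist knot. -/
def knotElement (x y : Q) (Z : Equiv.Perm Q) (j s : ℤ) : Q := (Z ^ j) (dihedralSeq x y s)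

theorem knotElement_add_three (h : TwistRelations k x y c Z) (j s t : ℤ) :
    knotElement x y Z (j + 3 * t) s = knotElement x y Z j s := by
  rw [knotElement, zpow_add, zpow_mul, zpow_ofNat, h.pow_three, one_zpow, mul_one]
  rfl

theorem act'_knotElement (h : TwistRelations k x y c Z) (j s : ℤ) :
    ∃ s', act' x (knotElement x y Z j s) = knotElement x y Z j s' := by
  -- The representative of `j` mod 3 in {-1, 0, 1}: one reflection is known for each of these
  -- levels.
  obtain ⟨i, t, hi, rfl⟩ : ∃ i t, (i = 0 ∨ i = 1 ∨ i = -1) ∧ j = i + 3 * t :=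
    ⟨(j + 1) % 3 - 1, (j + 1) / 3, by omega, by omega⟩
  simp only [h.knotElement_add_three]
  rcases hi with rfl | rfl | rfl
  · exact ⟨-s, act'_apply_dihedralSeq h.hx h.hy s⟩
  · exact ⟨_, by simpa [knotElement] using h.reflection_zpow_one s⟩
  · exact ⟨_, by simpa only [knotElement, zpow_neg_one] using h.reflection_zpow_neg_one s⟩

/-- The elements of the component of the circle. -/
def circleElement (x c : Q) (Z : Equiv.Perm Q) (b : Bool) (j : Fin 4) : Q :=
  (if b then act' x else 1)
    (![c, act' x (Z (act' x c)), act' x (Z⁻¹ (act' x c)), Z (act' x (Z (act' x c)))] j)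

theorem act'_circleElement (h : TwistRelations k x y c Z) (b : Bool) (j : Fin 4) :
    act' x (circleElement x c Z b j) = circleElement x c Z (!b) j := by
  cases b
  · rfl
  · exact h.act'_act' _

/-! ### The action on the circle component. -/

theorem symmProd_zpow_circle (h : TwistRelations k x y c Z) (i : ℤ) :
    (symmProd x y ^ i) c = c := by
  have : symmProd x y ∈ MulAction.stabilizer (Equiv.Perm Q) c := h.symmProd_circle
  exact zpow_mem this i

/-- The points fixed by all powers of R are preserved by Z, which commutes with R, and by X, which
inverts R. -/
theorem symmProd_zpow_circleElement (h : TwistRelations k x y c Z) (i : ℤ) (b : Bool) (j : Fin 4) :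
    (symmProd x y ^ i) (circleElement x c Z b j) = circleElement x c Z b j := by
  have hX : ∀ {q}, (∀ i : ℤ, (symmProd x y ^ i) q = q) →
      ∀ i : ℤ, (symmProd x y ^ i) (act' x q) = act' x q := by
    intro q hq i
    rw [← neg_neg i, ← h.act'_zpow_symmProd, hq]
  have hZ : ∀ {q}, (∀ i : ℤ, (symmProd x y ^ i) q = q) →
      ∀ i : ℤ, (symmProd x y ^ i) (Z q) = Z q := by
    intro q hq i
    rw [← zpow_one Z, ← h.zpow_zpow_symmProd, hq]
  have hZ' : ∀ {q}, (∀ i : ℤ, (symmProd x y ^ i) q = q) →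
      ∀ i : ℤ, (symmProd x y ^ i) (Z⁻¹ q) = Z⁻¹ q := by
    intro q hq i
    rw [← zpow_neg_one Z, ← h.zpow_zpow_symmProd, hq]
  have key : ∀ i : ℤ, (symmProd x y ^ i) (circleElement x c Z false j) =
      circleElement x c Z false j := by
    have hc := h.symmProd_zpow_circle
    fin_cases j
    · exact hc
    · exact hX (hZ (hX hc))
    · exact hX (hZ' (hX hc))
    · exact hZ (hX (hZ (hX hc)))
  cases b
  · exact key i
  · exact hX key i

/-- The clasp relation at c, which is fixed by both R and Z; one X cancels. -/
theorem circle_conj (h : TwistRelations k x y c Z) :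
    Z (act' x (Z⁻¹ (act' x c))) = act' x (Z (act' x c)) := by
  have h₁ := h.clasp_relation_apply c
  rw [h.symmProd_zpow_circle, show Z⁻¹ c = c by rw [Equiv.Perm.inv_eq_iff_eq, h.apply_circle]] at h₁
  rw [← h₁, h.act'_act']

/-- The clasp relation at XZ⁻¹Xc, where R is trivial, reads XZXZXc = Z(XZ⁻¹XZ⁻¹Xc); by `circle_conj`
and Z² = Z⁻¹ the argument of the outer Z is again XZXZXc. -/
theorem circle_fixed (h : TwistRelations k x y c Z) :
    Z (act' x (Z (act' x (Z (act' x c))))) = act' x (Z (act' x (Z (act' x c)))) := by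
  have h₁ := h.clasp_relation_apply (act' x (Z⁻¹ (act' x c)))
  have h₂ : act' x (Z (act' x (Z (act' x c)))) = act' x (Z⁻¹ (act' x (Z⁻¹ (act' x c)))) := by
    rw [← h.circle_conj, h.apply_apply]
  have h₃ : (symmProd x y ^ (2 * k - 1)) (act' x (Z⁻¹ (act' x c))) = act' x (Z⁻¹ (act' x c)) :=
    h.symmProd_zpow_circleElement (2 * k - 1) false 2
  rw [h.act'_act', h.inv_inv_apply, h₃] at h₁
  conv_rhs => rw [h₁, ← h₂]

/-- On the eight labels Z acts with two fixed points, (false, 0) and (true, 3), and two 3-cycles: 1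
→ 3 → 2 → 1 for `false` and 0 → 1 → 2 → 0 for `true`. -/
theorem apply_circleElement (h : TwistRelations k x y c Z) (b : Bool) (j : Fin 4) :
    ∃ j', Z (circleElement x c Z b j) = circleElement x c Z b j' := by
  cases b
  · fin_cases j
    · exact ⟨0, h.apply_circle⟩
    · exact ⟨3, rfl⟩
    · exact ⟨1, h.circle_conj⟩
    · refine ⟨2, ?_⟩
      change Z (Z (act' x (Z (act' x c)))) = act' x (Z⁻¹ (act' x c))
      rw [h.apply_apply, ← h.circle_conj, perm_inv_apply]
  · fin_cases j
    · exact ⟨1, (h.act'_act' _).symm⟩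
    · refine ⟨2, ?_⟩
      change Z (act' x (act' x (Z (act' x c)))) = act' x (act' x (Z⁻¹ (act' x c)))
      rw [h.act'_act', h.act'_act', h.apply_apply]
    · refine ⟨0, ?_⟩
      change Z (act' x (act' x (Z⁻¹ (act' x c)))) = act' x c
      rw [h.act'_act', perm_apply_inv]
    · exact ⟨3, h.circle_fixed⟩

/-! ### The two components as orbits of the group generated by X, R and Z. -/

theorem knotElement_mem_component (h : TwistRelations k x y c Z) (j s : ℤ) :
    knotElement x y Z j s ∈ quandleComponent x := by
  have hR := symmProd_mem_innerGroup x y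
  have hX := act'_mem_innerGroup x
  have hZ := h.mem_innerGroup
  refine mem_quandleComponent_iff.2 ?_
  rcases Int.even_or_odd' s with ⟨t, rfl | rfl⟩
  · exact ⟨Z ^ j * symmProd x y ^ (-t), mul_mem (zpow_mem hZ _) (zpow_mem hR _), by
      rw [knotElement, dihedralSeq_even, Equiv.Perm.mul_apply]⟩
  -- R preserves the parity of the index, so an odd term must be reached through the clasp: Z⁻¹XZ
  -- sends x to d_{2k-1}, and R^{k-1-t} moves this to d_{2t+1}.
  · refine ⟨Z ^ j * symmProd x y ^ (k - 1 - t) * Z⁻¹ * act' x * Z, mul_mem (mul_mem (mul_mem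
      (mul_mem (zpow_mem hZ _) (zpow_mem hR _)) (inv_mem hZ)) hX) hZ, ?_⟩
    have h₁ := h.reflection_zpow_one 0
    rw [dihedralSeq_zero] at h₁
    rw [Equiv.Perm.mul_apply, Equiv.Perm.mul_apply, Equiv.Perm.mul_apply, Equiv.Perm.mul_apply, h₁,
      perm_inv_apply, symmProd_zpow_dihedralSeq, knotElement]
    congr 2; ring

theorem circleElement_mem_component (h : TwistRelations k x y c Z) (b : Bool) (j : Fin 4) :
    circleElement x c Z b j ∈ quandleComponent c := by
  have hX := act'_mem_innerGroup x
  have hZ := h.mem_innerGroup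
  refine mem_quandleComponent_iff.2 ?_
  obtain ⟨p, hp, hj⟩ : ∃ p ∈ innerGroup Q, p c = circleElement x c Z false j := by
    fin_cases j
    · exact ⟨1, one_mem _, rfl⟩
    · exact ⟨act' x * Z * act' x, mul_mem (mul_mem hX hZ) hX, rfl⟩
    · exact ⟨act' x * Z⁻¹ * act' x, mul_mem (mul_mem hX (inv_mem hZ)) hX, rfl⟩
    · exact ⟨Z * act' x * Z * act' x, mul_mem (mul_mem (mul_mem hZ hX) hZ) hX, rfl⟩
  cases b
  · exact ⟨p, hp, hj⟩
  · exact ⟨act' x * p, mul_mem hX hp, by rw [Equiv.Perm.mul_apply, hj]; rfl⟩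

theorem act'_knotElement_mem (h : TwistRelations k x y c Z) {H : Subgroup (Equiv.Perm Q)}
    (hX : act' x ∈ H) (hR : symmProd x y ∈ H) (hZ : Z ∈ H) (j s : ℤ) :
    act' (knotElement x y Z j s) ∈ H := by
  rw [knotElement, act'_inner (zpow_mem h.mem_innerGroup _), act'_dihedralSeq h.hx h.hy]
  exact mul_mem (mul_mem (zpow_mem hZ _) (mul_mem hX (zpow_mem hR _))) (inv_mem (zpow_mem hZ _))

theorem act'_circleElement_mem (h : TwistRelations k x y c Z) {H : Subgroup (Equiv.Perm Q)}
    (hX : act' x ∈ H) (hZ : Z ∈ H) (b : Bool) (j : Fin 4) :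
    act' (circleElement x c Z b j) ∈ H := by
  have hc : act' c ∈ H := by
    rcases h.circle with rfl | rfl
    · exact hZ
    · exact inv_mem_iff.1 hZ
  have hX' : ∀ {q}, act' q ∈ H → act' (act' x q) ∈ H := fun hq => by
    rw [act'_inner (act'_mem_innerGroup x)]
    exact mul_mem (mul_mem hX hq) (inv_mem hX)
  have hZ' : ∀ {q}, act' q ∈ H → act' (Z q) ∈ H := fun hq => by
    rw [act'_inner h.mem_innerGroup]
    exact mul_mem (mul_mem hZ hq) (inv_mem hZ)
  have hZ'' : ∀ {q}, act' q ∈ H → act' (Z⁻¹ q) ∈ H := fun hq => by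
    rw [act'_inner (inv_mem h.mem_innerGroup)]
    exact mul_mem (mul_mem (inv_mem hZ) hq) (inv_mem (inv_mem hZ))
  have key : act' (circleElement x c Z false j) ∈ H := by
    fin_cases j
    · exact hc
    · exact hX' (hZ' (hX' hc))
    · exact hX' (hZ'' (hX' hc))
    · exact hZ' (hX' (hZ' (hX' hc)))
  cases b
  · exact key
  · exact hX' key

-- Closure of the list under the three generators, put as membership in a stabilizer so that it
-- passes to the whole inner group.
open scoped Pointwise in
theorem mem_stabilizer_knot (h : TwistRelations k x y c Z) :
    let S := MulAction.stabilizer (Equiv.Perm Q) {q | ∃ j s, q = knotElement x y Z j s}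
    act' x ∈ S ∧ symmProd x y ∈ S ∧ Z ∈ S := by
  refine ⟨?_, ?_, ?_⟩
  · have hX : ∀ q, (∃ j s, q = knotElement x y Z j s) →
        ∃ j s, act' x q = knotElement x y Z j s := by
      rintro _ ⟨j, s, rfl⟩
      obtain ⟨s', hs⟩ := h.act'_knotElement j s
      exact ⟨j, s', hs⟩
    exact MulAction.mem_stabilizer_set.2 fun q =>
      ⟨fun hq => by
        have := hX _ hq
        rwa [Equiv.Perm.smul_def, h.act'_act'] at this, hX q⟩
  · have hR : ∀ (i : ℤ) q, (∃ j s, q = knotElement x y Z j s) →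
        ∃ j s, (symmProd x y ^ i) q = knotElement x y Z j s := by
      rintro i _ ⟨j, s, rfl⟩
      exact ⟨j, s - 2 * i, by
        rw [knotElement, ← h.zpow_zpow_symmProd, symmProd_zpow_dihedralSeq, knotElement]⟩
    refine MulAction.mem_stabilizer_set.2 fun q => ⟨fun hq => ?_, fun hq => ?_⟩
    · have := hR (-1) _ hq
      rwa [zpow_neg_one, Equiv.Perm.smul_def, perm_inv_apply] at this
    · have := hR 1 _ hq
      rwa [zpow_one] at this
  · refine MulAction.mem_stabilizer_set.2 fun q => ⟨?_, ?_⟩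
    · rintro ⟨j, s, hq⟩
      refine ⟨j - 1, s, ?_⟩
      rw [← perm_inv_apply Z q, ← Equiv.Perm.smul_def Z q, hq, knotElement, knotElement,
        ← Equiv.Perm.mul_apply, ← zpow_neg_one, ← zpow_add]
      congr 2; ring
    · rintro ⟨j, s, rfl⟩
      refine ⟨1 + j, s, ?_⟩
      rw [Equiv.Perm.smul_def, knotElement, knotElement, zpow_one_add, Equiv.Perm.mul_apply]

open scoped Pointwise in
theorem mem_stabilizer_circle (h : TwistRelations k x y c Z) :
    let S := MulAction.stabilizer (Equiv.Perm Q) {q | ∃ b j, q = circleElement x c Z b j}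
    act' x ∈ S ∧ symmProd x y ∈ S ∧ Z ∈ S := by
  refine ⟨?_, ?_, ?_⟩
  · have hX : ∀ q, (∃ b j, q = circleElement x c Z b j) →
        ∃ b j, act' x q = circleElement x c Z b j := by
      rintro _ ⟨b, j, rfl⟩
      exact ⟨!b, j, h.act'_circleElement b j⟩
    exact MulAction.mem_stabilizer_set.2 fun q =>
      ⟨fun hq => by
        have := hX _ hq
        rwa [Equiv.Perm.smul_def, h.act'_act'] at this, hX q⟩
  · have hR : ∀ (i : ℤ) q, (∃ b j, q = circleElement x c Z b j) →
        ∃ b j, (symmProd x y ^ i) q = circleElement x c Z b j := by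
      rintro i _ ⟨b, j, rfl⟩
      exact ⟨b, j, h.symmProd_zpow_circleElement i b j⟩
    refine MulAction.mem_stabilizer_set.2 fun q => ⟨fun hq => ?_, fun hq => ?_⟩
    · have := hR (-1) _ hq
      rwa [zpow_neg_one, Equiv.Perm.smul_def, perm_inv_apply] at this
    · have := hR 1 _ hq
      rwa [zpow_one] at this
  · have hZ : ∀ q, (∃ b j, q = circleElement x c Z b j) →
        ∃ b j, Z q = circleElement x c Z b j := by
      rintro _ ⟨b, j, rfl⟩
      obtain ⟨j', hj⟩ := h.apply_circleElement b j
      exact ⟨b, j', hj⟩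
    refine MulAction.mem_stabilizer_set.2 fun q => ⟨fun hq => ?_, hZ q⟩
    have := hZ _ (hZ _ hq)
    rwa [h.apply_apply, Equiv.Perm.smul_def, perm_inv_apply] at this

theorem quandleComponent_knot (h : TwistRelations k x y c Z)
    (hQ : ∀ H : Subgroup (Equiv.Perm Q), act' x ∈ H → symmProd x y ∈ H → Z ∈ H →
      innerGroup Q ≤ H) :
    quandleComponent x = {q | ∃ j s, q = knotElement x y Z j s} := by
  ext q
  constructor
  · intro hq
    obtain ⟨p, hp, rfl⟩ := mem_quandleComponent_iff.1 hq
    obtain ⟨hX, hR, hZ⟩ := h.mem_stabilizer_knot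
    exact (MulAction.mem_stabilizer_set.1 (hQ _ hX hR hZ hp) x).2
      ⟨0, 0, (dihedralSeq_zero x y).symm⟩
  · rintro ⟨j, s, rfl⟩
    exact h.knotElement_mem_component j s

theorem quandleComponent_circle (h : TwistRelations k x y c Z)
    (hQ : ∀ H : Subgroup (Equiv.Perm Q), act' x ∈ H → symmProd x y ∈ H → Z ∈ H →
      innerGroup Q ≤ H) :
    quandleComponent c = {q | ∃ b j, q = circleElement x c Z b j} := by
  ext q
  constructor
  · intro hq
    obtain ⟨p, hp, rfl⟩ := mem_quandleComponent_iff.1 hq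
    obtain ⟨hX, hR, hZ⟩ := h.mem_stabilizer_circle
    exact (MulAction.mem_stabilizer_set.1 (hQ _ hX hR hZ hp) c).2 ⟨false, 0, rfl⟩
  · rintro ⟨b, j, rfl⟩
    exact h.circleElement_mem_component b j

/-- The elements of the two components, indexed by finite types. -/
def element (k : ℤ) (x y c : Q) (Z : Equiv.Perm Q) :
    Fin 3 × Fin (6 * (2 * k - 1).natAbs) ⊕ Bool × Fin 4 → Q :=
  Sum.elim (fun u => knotElement x y Z u.1 u.2) (fun u => circleElement x c Z u.1 u.2)

theorem range_knotElement (h : TwistRelations k x y c Z) :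
    Set.range (fun u => element k x y c Z (.inl u)) = {q | ∃ j s, q = knotElement x y Z j s} := by
  ext q
  constructor
  · rintro ⟨u, rfl⟩
    exact ⟨_, _, rfl⟩
  · rintro ⟨j, s, rfl⟩
    have hn : ((6 * (2 * k - 1).natAbs : ℕ) : ℤ) = |6 * (2 * k - 1)| := by
      rw [← Int.natCast_natAbs, Int.natAbs_mul]; rfl
    -- 2k - 1 is odd, hence nonzero.
    have h0 : 0 < |6 * (2 * k - 1)| := abs_pos.2 (by omega)
    have hs := Int.emod_nonneg s h0.ne'
    have hs' := Int.emod_lt_of_pos s h0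
    refine ⟨(⟨(j % 3).toNat, by omega⟩, ⟨(s % |6 * (2 * k - 1)|).toNat, by omega⟩), ?_⟩
    simp only [element, Sum.elim_inl]
    rw [Int.toNat_of_nonneg hs, Int.toNat_of_nonneg (by omega), Int.emod_abs,
      show j % 3 = j + 3 * (-(j / 3)) by omega, h.knotElement_add_three, knotElement,
      Int.emod_def, sub_eq_add_neg, ← mul_neg, h.dihedralSeq_add_mul, knotElement]

theorem range_circleElement :
    Set.range (fun u => element k x y c Z (.inr u)) =
      {q | ∃ b j, q = circleElement x c Z b j} := by
  ext q
  constructor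
  · rintro ⟨u, rfl⟩
    exact ⟨_, _, rfl⟩
  · rintro ⟨b, j, rfl⟩
    exact ⟨(b, j), rfl⟩

end TwistRelations

end TwistRelations

/-! ### The model: conjugation in `SL(2, 3) × DihedralGroup (3 * |2k - 1|)` -/

namespace TwistModel

open Rack (act')
open DihedralGroup (r sr)
open TwistRelations

abbrev SL23 : Type := Matrix.SpecialLinearGroup (Fin 2) (ZMod 3)

/-- An element of order `4` of `SL(2, 3)`. -/
def quarter : SL23 := ⟨!![0, 1; 2, 0], by decide⟩

/-- An element of order `3` of `SL(2, 3)`. -/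
def third : SL23 := ⟨!![1, 1; 0, 1], by decide⟩

/-! ### Arithmetic in the two factors of the model. -/

theorem quarter_pow_four : quarter ^ 4 = 1 := by decide

theorem third_pow_three : third ^ 3 = 1 := by decide

theorem quarter_sq_comm (g : SL23) : quarter ^ 2 * g = g * quarter ^ 2 := by
  revert g; decide

/-- `third` permutes cyclically the three subgroups of order 4 of the quaternion group in SL(2,3),
and each contains two elements of order 4. -/
theorem third_conj_quarter_inj : ∀ (j j' : Fin 3) (s s' : Fin 2),
    third ^ j.val * quarter ^ (1 + 2 * s.val) * (third ^ j.val)⁻¹ =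
      third ^ j'.val * quarter ^ (1 + 2 * s'.val) * (third ^ j'.val)⁻¹ → j = j' ∧ s = s' := by
  decide

/-- The conjugates of `g` by `1`, `qtq`, `qt⁻¹q` and `tqtq` for `q = quarter` and `t = third`. -/
def thirdConj (g : SL23) (j : Fin 4) : SL23 :=
  ![1, quarter * third * quarter, quarter * third⁻¹ * quarter,
      third * quarter * third * quarter] j * g *
    (![1, quarter * third * quarter, quarter * third⁻¹ * quarter,
      third * quarter * third * quarter] j)⁻¹

/-- The four values exhaust the conjugacy class of `third`. The inverse class is needed as well,
since the orientation of the circle decides which of the two contains the image of c. -/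
theorem thirdConj_injective : Function.Injective (thirdConj third) := by decide

theorem thirdConj_inv_injective : Function.Injective (thirdConj third⁻¹) := by decide

abbrev Model (k : ℤ) : Type := SL23 × DihedralGroup (3 * (2 * k - 1).natAbs)

/-- The class of `2 * k - 1`, an element of order `3`. -/
def oddClass (k : ℤ) : ZMod (3 * (2 * k - 1).natAbs) := ((2 * k - 1 : ℤ) : ZMod _)

theorem three_mul_eq_zero (k : ℤ) :
    3 * oddClass k = 0 := by
  have : ((3 * (2 * k - 1) : ℤ) : ZMod (3 * (2 * k - 1).natAbs)) = 0 := by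
    rw [ZMod.intCast_zmod_eq_zero_iff_dvd]
    push_cast
    exact mul_dvd_mul_left 3 ((abs_dvd _ _).2 dvd_rfl)
  rw [oddClass]
  exact_mod_cast this

/-- Separates the rotations by ±(2k - 1), hence the two halves of the circle component. -/
theorem two_mul_ne_zero (k : ℤ) :
    2 * oddClass k ≠ 0 := by
  intro h
  rw [oddClass] at h
  have h' : ((2 * (2 * k - 1) : ℤ) : ZMod (3 * (2 * k - 1).natAbs)) = 0 := by exact_mod_cast h
  rw [ZMod.intCast_zmod_eq_zero_iff_dvd] at h'
  push_cast at h'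
  have h2 : 3 * (2 * k - 1) ∣ 2 * (2 * k - 1) :=
    (mul_dvd_mul_left 3 ((dvd_abs _ _).2 dvd_rfl)).trans h'
  have h3 := Int.dvd_of_mul_dvd_mul_right (by omega) h2
  omega

/-- The image of `dihedralSeq x y i`. -/
def seqImage (k i : ℤ) : Model k := (quarter ^ (1 + 2 * i), sr i)

/-- The element of the model that acts as the symmetry at the circle, or its inverse. -/
def circleImage (k : ℤ) : Model k := (third, r (oddClass k))

theorem circleImage_pow_three (k : ℤ) : circleImage k ^ 3 = 1 := by
  refine Prod.ext third_pow_three ?_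
  change r _ ^ 3 = 1
  rw [DihedralGroup.r_pow, DihedralGroup.one_def]
  exact congrArg r ((mul_comm _ _).trans (three_mul_eq_zero k))

theorem quarter_zpow_congr {a b : ℤ} (h : a % 4 = b % 4) : quarter ^ a = quarter ^ b := by
  rw [← Int.emod_add_mul_ediv a 4, ← Int.emod_add_mul_ediv b 4, h, zpow_add, zpow_add, zpow_mul,
    zpow_mul, zpow_ofNat, quarter_pow_four, one_zpow, one_zpow]

/-! ### The listed elements have distinct images in the model. -/

variable {Q : Type} [Quandle Q] {k : ℤ} {x y c : Q} {Z : Equiv.Perm Q} {φ : Q → Model k}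

section

variable (hφ : ∀ a b, φ (act' a b) = φ a * φ b * (φ a)⁻¹) (hx : φ x = seqImage k 0)
  (hy : φ y = seqImage k 1) (hZ : (Z, circleImage k) ∈ intertwiners φ)
include hφ hx hy

theorem map_dihedralSeq (i : ℤ) : φ (dihedralSeq x y i) = seqImage k i := by
  -- The product of the images of x and y is (q · q³, sr 0 · sr 1) = (1, r 1), and conjugation by `r
  -- 1` lowers the index of a reflection by 2, as R does in the sequence.
  have hR : (symmProd x y, ((1, r 1) : Model k)) ∈ intertwiners φ := by
    have h : (act' x * act' y, φ x * φ y) ∈ intertwiners φ :=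
      mul_mem (show (act' x, φ x) ∈ intertwiners φ from hφ x)
        (show (act' y, φ y) ∈ intertwiners φ from hφ y)
    convert h using 2
    · rfl
    rw [hx, hy]
    refine Prod.ext ?_ ?_
    · change 1 = quarter ^ _ * quarter ^ _
      decide
    · simp [seqImage]
  have hR' : ∀ (i : ℤ) (q : Q), φ ((symmProd x y ^ i) q) =
      (1, r (i : ZMod _)) * φ q * ((1, r (i : ZMod _)) : Model k)⁻¹ := by
    intro i q
    have := (zpow_mem hR i) q
    simpa using this
  rcases Int.even_or_odd' i with ⟨t, rfl | rfl⟩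
  · rw [dihedralSeq_even, hR', hx]
    refine Prod.ext ?_ ?_
    · simp only [seqImage, Prod.fst_mul, Prod.fst_inv, one_mul, inv_one, mul_one]
      exact quarter_zpow_congr (by omega)
    · simp [seqImage]
      ring
  · rw [dihedralSeq_odd, hR', hy]
    refine Prod.ext ?_ ?_
    · simp only [seqImage, Prod.fst_mul, Prod.fst_inv, one_mul, inv_one, mul_one]
      exact quarter_zpow_congr (by omega)
    · simp [seqImage]
      ring

include hZ

theorem map_knotElement (j s : ℤ) : φ (knotElement x y Z j s) =
    (third ^ j * quarter ^ (1 + 2 * s) * (third ^ j)⁻¹,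
      sr ((s : ZMod (3 * (2 * k - 1).natAbs)) - 2 * (j : ZMod _) * oddClass k)) := by
  have h : (Z ^ j, circleImage k ^ j) ∈ intertwiners φ := zpow_mem hZ j
  rw [knotElement, mem_intertwiners_iff.1 h, map_dihedralSeq hφ hx hy]
  refine Prod.ext rfl ?_
  simp [seqImage, circleImage]
  ring

/-- The SL(2,3) coordinate gives `j` and the parity of `s`; once `j` is known, the dihedral
coordinate gives `s` mod 3|2k - 1|. This modulus is odd, so the Chinese remainder theorem gives `s`
mod 6|2k - 1|. -/
theorem knotElement_injective :
    Function.Injective fun u => element k x y c Z (.inl u) := by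
  rintro ⟨j, s⟩ ⟨j', s'⟩ h
  have h' := congrArg φ h
  simp only [element, Sum.elim_inl] at h'
  rw [map_knotElement hφ hx hy hZ, map_knotElement hφ hx hy hZ, Prod.mk.injEq] at h'
  obtain ⟨h1, h2⟩ := h'
  have hs : ∀ s : ℕ, quarter ^ (1 + 2 * (s : ℤ)) = quarter ^ (1 + 2 * (s % 2)) := by
    intro s
    rw [← zpow_natCast]
    exact quarter_zpow_congr (by omega)
  rw [hs, hs, zpow_natCast, zpow_natCast] at h1
  obtain ⟨rfl, h3⟩ := third_conj_quarter_inj j j' ⟨s % 2, by omega⟩ ⟨s' % 2, by omega⟩ h1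
  have h4 : s.val % 2 = s'.val % 2 := by simpa using h3
  rw [DihedralGroup.sr.injEq, sub_left_inj] at h2
  have h5 : ((s.val : ℕ) : ZMod (3 * (2 * k - 1).natAbs)) = (s'.val : ℕ) := by exact_mod_cast h2
  rw [ZMod.natCast_eq_natCast_iff] at h5
  have hb := s.isLt
  have hb' := s'.isLt
  have h6 : s.val ≡ s'.val [MOD 2 * (3 * (2 * k - 1).natAbs)] := by
    refine (Nat.modEq_and_modEq_iff_modEq_mul ?_).1 ⟨h4, h5⟩
    rw [Nat.coprime_two_left, Nat.odd_iff]
    omega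
  rw [← mul_assoc] at h6
  have h7 : s = s' := Fin.ext (h6.eq_of_lt_of_lt hb hb')
  rw [h7]

omit hy in
theorem map_circleElement {g : SL23} {w : ZMod (3 * (2 * k - 1).natAbs)} (hc : φ c = (g, r w))
    (b : Bool) (j : Fin 4) :
    φ (circleElement x c Z b j) =
      if b then (quarter * thirdConj g j * quarter⁻¹, r (-w)) else (thirdConj g j, r w) := by
  have hX : ∀ {q g w}, φ q = (g, r w) → φ (act' x q) = (quarter * g * quarter⁻¹, r (-w)) := by
    intro q g w hq
    rw [hφ, hx, hq]
    refine Prod.ext ?_ ?_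
    · simp [seqImage]
    · simp [seqImage]
  have hZ₁ : ∀ {q g w}, φ q = (g, r w) → φ (Z q) = (third * g * third⁻¹, r w) := by
    intro q g w hq
    rw [mem_intertwiners_iff.1 hZ, hq]
    refine Prod.ext rfl ?_
    simp [circleImage]
  have hZ₂ : ∀ {q g w}, φ q = (g, r w) → φ (Z⁻¹ q) = (third⁻¹ * g * third, r w) := by
    intro q g w hq
    have h : (Z⁻¹, (circleImage k)⁻¹) ∈ intertwiners φ := inv_mem hZ
    rw [mem_intertwiners_iff.1 h, hq]
    refine Prod.ext ?_ ?_
    · simp [circleImage]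
    · simp [circleImage]
  have key : φ (circleElement x c Z false j) = (thirdConj g j, r w) := by
    fin_cases j
    · exact hc.trans (by simp [thirdConj])
    · exact (hX (hZ₁ (hX hc))).trans (by simp [thirdConj, mul_assoc])
    · exact (hX (hZ₂ (hX hc))).trans (by simp [thirdConj, mul_assoc])
    · exact (hZ₁ (hX (hZ₁ (hX hc)))).trans (by simp [thirdConj, mul_assoc])
  cases b
  · exact key
  · exact hX key

variable (hc : φ c = circleImage k ∨ φ c = (circleImage k)⁻¹)
include hc

-- The rotation coordinate separates the two values of `b`, and the SL(2,3) coordinate the four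
-- values of `j`.
omit hy in
theorem map_circleElement_injective :
    Function.Injective fun u => element k x y c Z (.inr u) := by
  obtain ⟨g, w, hgw, hg, hw⟩ : ∃ g w, φ c = (g, r w) ∧ Function.Injective (thirdConj g) ∧
      2 * w ≠ 0 := by
    rcases hc with hc | hc
    · exact ⟨_, _, hc, thirdConj_injective, two_mul_ne_zero k⟩
    · refine ⟨third⁻¹, -oddClass k, hc, thirdConj_inv_injective, ?_⟩
      rw [mul_neg, neg_ne_zero]
      exact two_mul_ne_zero k
  have hne : r w ≠ r (-w) := by
    intro h
    rw [DihedralGroup.r.injEq, eq_neg_iff_add_eq_zero, ← two_mul] at h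
    exact hw h
  rintro ⟨b, j⟩ ⟨b', j'⟩ h
  have h' := congrArg φ h
  simp only [element, Sum.elim_inr] at h'
  rw [map_circleElement hφ hx hZ hgw, map_circleElement hφ hx hZ hgw] at h'
  cases b <;> cases b'
  · rw [hg (Prod.ext_iff.1 h').1]
  · exact absurd (Prod.ext_iff.1 h').2 hne
  · exact absurd (Prod.ext_iff.1 h').2.symm hne
  · rw [hg (mul_left_cancel (mul_right_cancel (Prod.ext_iff.1 h').1))]

theorem element_injective : Function.Injective (element k x y c Z) := by
  -- Knot elements map to reflections of the dihedral group, circle elements to rotations.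
  have hd : ∀ u v, element k x y c Z (.inl u) ≠ element k x y c Z (.inr v) := by
    rintro u ⟨b, j⟩ h
    have h' := congrArg φ h
    simp only [element, Sum.elim_inl, Sum.elim_inr] at h'
    obtain ⟨g, w, hgw⟩ : ∃ g w, φ c = (g, r w) := by
      rcases hc with hc | hc
      · exact ⟨_, _, hc⟩
      · exact ⟨_, _, hc⟩
    rw [map_knotElement hφ hx hy hZ, map_circleElement hφ hx hZ hgw] at h'
    have h2 := (Prod.ext_iff.1 h').2
    cases b <;> simp at h2
  rintro (u | u) (v | v) h
  · rw [knotElement_injective hφ hx hy hZ h]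
  · exact absurd h (hd u v)
  · exact absurd h.symm (hd v u)
  · rw [map_circleElement_injective hφ hx hZ hc h]

end

end TwistModel

/-! ### Wirtinger relations in the fundamental `N`-quandle -/

namespace LinkDiagram

open Rack (act')

variable {n : ℕ} (D : LinkDiagram n) (o : D.Orientation) (N : Fin n → ℕ)

theorem arc_over {c : D.Crossing} {i : Fin 4} (h : D.IsOver c i) :
    D.arc o N (D.edge (c, i)) = D.arc o N (D.edge (c, i + 2)) :=
  Quotient.sound (QTerm.Rel.of (NWirtingerRel.wirtinger (WirtingerRel.over c i h)))

theorem arc_under {c : D.Crossing} {i : Fin 4} (h : D.IsOver c i) (h' : o.out (c, i) = true) :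
    D.arc o N (D.edge (c, i + 1)) =
      act' (D.arc o N (D.edge (c, i))) (D.arc o N (D.edge (c, i + 3))) :=
  Quotient.sound (QTerm.Rel.of (NWirtingerRel.wirtinger (WirtingerRel.under c i h h')))

/-- The power relations are imposed on generators only; they hold everywhere because this power is
an inner automorphism. -/
theorem act'_arc_pow (e : D.Edge) : act' (D.arc o N e) ^ N (D.comp e) = 1 := by
  refine PresentedQuandle.inner_eq_one (pow_mem (act'_mem_innerGroup _) _) fun x => ?_
  have key : ∀ (m : ℕ) (s : QTerm D.Edge),
      PresentedQuandle.mk (NWirtingerRel D o N) ((fun s => QTerm.rhd s (.of e))^[m] s) =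
        (act' (D.arc o N e) ^ m) (PresentedQuandle.mk _ s) := by
    intro m
    induction m with
    | zero => exact fun s => rfl
    | succ m ih =>
      intro s
      rw [Function.iterate_succ_apply, ih, pow_succ, Equiv.Perm.mul_apply]
      rfl
  rw [← key]
  exact Quotient.sound (QTerm.Rel.of (NWirtingerRel.power x e))

theorem isOver_add_two {c : D.Crossing} {i : Fin 4} (h : D.IsOver c i) : D.IsOver c (i + 2) := by
  have hi : ∀ i : Fin 4, (i + 2).val % 2 = i.val % 2 := by decide
  rwa [PDCode.IsOver, hi i]

/-- At a crossing with an involutive over-strand the orientation does not matter. -/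
theorem arc_under_of_involutive {c : D.Crossing} {i : Fin 4} (h : D.IsOver c i)
    (hN : N (D.comp (D.edge (c, i))) = 2) :
    D.arc o N (D.edge (c, i + 1)) =
      act' (D.arc o N (D.edge (c, i))) (D.arc o N (D.edge (c, i + 3))) := by
  by_cases h' : o.out (c, i) = true
  · exact D.arc_under o N h h'
  -- The over-strand points out of the end `i + 2`; seen from there the two under-edges change
  -- places, which an involution undoes.
  · have h₁ := D.arc_under o N (D.isOver_add_two h) (by rw [o.through]; simpa using h')
    rw [← D.arc_over o N h, add_assoc, add_assoc] at h₁
    change D.arc o N (D.edge (c, i + 3)) = act' _ (D.arc o N (D.edge (c, i + 1))) at h₁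
    have h₂ := D.act'_arc_pow o N (D.edge (c, i))
    rw [hN, pow_two] at h₂
    rw [h₁, ← Equiv.Perm.mul_apply, h₂, Equiv.Perm.one_apply]

end LinkDiagram

theorem eq_zero_or_two {i : Fin 4} (h : i.val % 2 = 0 ↔ true = true) : i = 0 ∨ i = 2 := by
  revert i; decide

theorem eq_one_or_three {i : Fin 4} (h : i.val % 2 = 0 ↔ false = true) : i = 1 ∨ i = 3 := by
  revert i; decide

/-! ### The fundamental `(2, 3)`-quandle of `M_k` -/

namespace TwistLink

open Rack (act')
open TwistRelations

/-! ### All arcs in terms of the two strands inside the circle and the circle. -/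

section Arcs

variable (k : ℤ) (o : (twistLink k).Orientation)

/-- The element of the fundamental `(2, 3)`-quandle of `M_k` given by an edge. -/
def linkArc (e : Edge k.natAbs) : (twistLink k).NQuandle o ![2, 3] := (twistLink k).arc o ![2, 3] e

theorem linkArc_over (c : Crossing k.natAbs) (i : Fin 4)
    (h : i.val % 2 = 0 ↔ overEven (decide (0 < k)) c = true) :
    linkArc k o (ends c i) = linkArc k o (ends c (i + 2)) :=
  (twistLink k).arc_over o ![2, 3] h

theorem linkArc_under (c : Crossing k.natAbs) (i : Fin 4)
    (h : i.val % 2 = 0 ↔ overEven (decide (0 < k)) c = true) (h' : comp (ends c i) = 0) :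
    linkArc k o (ends c (i + 1)) =
      act' (linkArc k o (ends c i)) (linkArc k o (ends c (i + 3))) :=
  (twistLink k).arc_under_of_involutive o ![2, 3] h
    (show ![2, 3] (comp (ends c i)) = 2 by rw [h']; rfl)

/-- Whether the edge at the end `i` of the crossing `c` is directed away from `c`. -/
def outAt (c : Crossing k.natAbs) (i : Fin 4) : Bool := o.out (c, i)

theorem outAt_add_two (c : Crossing k.natAbs) (i : Fin 4) :
    outAt k o c (i + 2) = !outAt k o c i := o.through c i

theorem outAt_along {c c' : Crossing k.natAbs} {i j : Fin 4} (h : (c, i) ≠ (c', j))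
    (h' : ends c i = ends c' j) : outAt k o c' j = !outAt k o c i := o.along (c, i) (c', j) h h'

/-- The edge `cW` carries the direction of the circle from one left crossing to the other, so a
single Z serves both strands. -/
theorem outAt_botL : outAt k o .botL 1 = outAt k o .topL 1 := by
  have h₁ := outAt_along k o (c := .topL) (i := 1) (c' := .botL) (j := 3) (by simp) rfl
  have h₂ : outAt k o .botL 3 = _ := outAt_add_two k o .botL 1
  rw [h₂] at h₁
  simpa using h₁

theorem linkArc_under_of_out (c : Crossing k.natAbs) (i : Fin 4)
    (h : i.val % 2 = 0 ↔ overEven (decide (0 < k)) c = true)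
    (h' : outAt k o c i = true) :
    linkArc k o (ends c (i + 1)) =
      act' (linkArc k o (ends c i)) (linkArc k o (ends c (i + 3))) :=
  (twistLink k).arc_under o ![2, 3] h h'

/-- The symmetry at the circle that leads from the strands inside to those on the left. -/
def circlePerm : Equiv.Perm ((twistLink k).NQuandle o ![2, 3]) :=
  if outAt k o .topL 1 then (act' (linkArc k o .cN))⁻¹ else act' (linkArc k o .cN)

theorem linkArc_cW : linkArc k o .cW = linkArc k o .cN := linkArc_over k o .topL 1 (by simp [overEven])

theorem linkArc_cS : linkArc k o .cS = linkArc k o .cN :=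
  (linkArc_over k o .botL 1 (by simp [overEven])).trans (linkArc_cW k o)

theorem linkArc_cE : linkArc k o .cE = act' (linkArc k o .topIn) (linkArc k o .cN) :=
  linkArc_under k o .topR 0 (by simp [overEven]) rfl

theorem linkArc_a : linkArc k o .a = circlePerm k o (linkArc k o .topIn) := by
  rw [circlePerm]
  split_ifs with h
  · have h₁ : linkArc k o .topIn = act' (linkArc k o .cW) (linkArc k o .a) :=
      linkArc_under_of_out k o .topL 1 (by simp [overEven]) h
    rw [h₁, linkArc_cW, perm_inv_apply]
  · refine linkArc_under_of_out k o .topL 3 (by simp [overEven]) ?_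
    exact (outAt_add_two k o .topL 1).trans (by simpa using h)

theorem linkArc_b : linkArc k o .b = circlePerm k o (linkArc k o .botIn) := by
  rw [circlePerm]
  split_ifs with h
  · have h₁ : linkArc k o .botIn = act' (linkArc k o .cS) (linkArc k o .b) :=
      linkArc_under_of_out k o .botL 1 (by simp [overEven]) ((outAt_botL k o).trans h)
    rw [h₁, linkArc_cS, perm_inv_apply]
  · have h₁ : linkArc k o .b = act' (linkArc k o .cW) (linkArc k o .botIn) := by
      refine linkArc_under_of_out k o .botL 3 (by simp [overEven]) ?_
      exact (outAt_add_two k o .botL 1).trans (by simpa [outAt_botL] using h)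
    rw [h₁, linkArc_cW]

theorem act'_linkArc_mul_self {e : Edge k.natAbs} (h : comp e = 0) :
    act' (linkArc k o e) * act' (linkArc k o e) = 1 := by
  have h₁ : act' (linkArc k o e) ^ ![2, 3] (comp e) = 1 := (twistLink k).act'_arc_pow o ![2, 3] e
  rw [h] at h₁
  rw [← pow_two]
  exact h₁

theorem circlePerm_pow_three : circlePerm k o ^ 3 = 1 := by
  have h₁ : act' (linkArc k o .cN) ^ 3 = 1 := (twistLink k).act'_arc_pow o ![2, 3] Edge.cN
  rw [circlePerm]
  split_ifs
  · rw [inv_pow, h₁, inv_one]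
  · exact h₁

/-- A right-handed half-twist turns the pair (d_a, d_{a+1}) into (d_{a-1}, d_a): the over-arc d_a
moves to the bottom and reflects d_{a+1} to d_{a-1}. A left-handed one gives (d_{a+1}, d_{a+2}). -/
theorem linkArc_strands (j : Fin (k.natAbs + 1)) :
    linkArc k o (.top j) =
      dihedralSeq (linkArc k o .topIn) (linkArc k o .botIn) (-(k.sign * j.val)) ∧
    linkArc k o (.bot j) =
      dihedralSeq (linkArc k o .topIn) (linkArc k o .botIn) (1 - k.sign * j.val) := by
  have hx := act'_linkArc_mul_self k o (e := .topIn) rfl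
  have hy := act'_linkArc_mul_self k o (e := .botIn) rfl
  induction j using Fin.induction with
  | zero =>
    have h₁ : linkArc k o .topIn = linkArc k o (.top 0) := linkArc_over k o .topR 0 (by simp [overEven])
    have h₂ : linkArc k o .botIn = linkArc k o (.bot 0) := linkArc_over k o .botR 0 (by simp [overEven])
    simp [dihedralSeq_zero, dihedralSeq_one, h₁, h₂]
  | succ i ih =>
    obtain ⟨ht, hb⟩ := ih
    rw [Fin.val_castSucc] at ht hb
    have hi := i.isLt
    by_cases hk : 0 < k
    · have hover : (0 : Fin 4).val % 2 = 0 ↔ overEven (decide (0 < k)) (.twist i) = true := by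
        simp [overEven, hk]
      have h₁ : linkArc k o (.top i.castSucc) = linkArc k o (.bot i.succ) :=
        linkArc_over k o (.twist i) 0 hover
      have h₂ : linkArc k o (.bot i.castSucc) =
          act' (linkArc k o (.top i.castSucc)) (linkArc k o (.top i.succ)) :=
        linkArc_under k o (.twist i) 0 hover rfl
      have h₃ := act'_linkArc_mul_self k o (e := .top i.castSucc) rfl
      have h₄ : linkArc k o (.top i.succ) =
          act' (linkArc k o (.top i.castSucc)) (linkArc k o (.bot i.castSucc)) := by
        rw [h₂, ← Equiv.Perm.mul_apply, h₃, Equiv.Perm.one_apply]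
      rw [h₄, ← h₁, ht, hb, act'_dihedralSeq_apply hx hy, Int.sign_eq_one_of_pos hk, Fin.val_succ]
      constructor <;> congr 1 <;> push_cast <;> ring
    · have hover : (1 : Fin 4).val % 2 = 0 ↔ overEven (decide (0 < k)) (.twist i) = true := by
        simp [overEven, hk]
      have h₁ : linkArc k o (.bot i.castSucc) = linkArc k o (.top i.succ) :=
        linkArc_over k o (.twist i) 1 hover
      have h₂ : linkArc k o (.bot i.succ) =
          act' (linkArc k o (.bot i.castSucc)) (linkArc k o (.top i.castSucc)) :=
        linkArc_under k o (.twist i) 1 hover rfl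
      rw [h₂, ← h₁, ht, hb, act'_dihedralSeq_apply hx hy,
        Int.sign_eq_neg_one_of_neg (by omega), Fin.val_succ]
      constructor <;> congr 1 <;> push_cast <;> ring

theorem linkArc_top_last : linkArc k o (.top (Fin.last _)) =
    dihedralSeq (linkArc k o .topIn) (linkArc k o .botIn) (-k) := by
  rw [(linkArc_strands k o _).1, Fin.val_last, Int.sign_mul_natAbs]

theorem linkArc_bot_last : linkArc k o (.bot (Fin.last _)) =
    dihedralSeq (linkArc k o .topIn) (linkArc k o .botIn) (1 - k) := by
  rw [(linkArc_strands k o _).2, Fin.val_last, Int.sign_mul_natAbs]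

theorem linkArc_claspL : linkArc k o .claspL =
    dihedralSeq (linkArc k o .topIn) (linkArc k o .botIn) (1 - k) :=
  (linkArc_over k o .claspTop 1 (by simp [overEven])).trans (linkArc_bot_last k o)

theorem linkArc_claspR : linkArc k o .claspR = linkArc k o .a :=
  (linkArc_over k o .claspBot 1 (by simp [overEven])).symm

theorem twistRelations : TwistRelations k (linkArc k o .topIn) (linkArc k o .botIn)
    (linkArc k o .cN) (circlePerm k o) where
  hx := act'_linkArc_mul_self k o rfl
  hy := act'_linkArc_mul_self k o rfl
  pow_three := circlePerm_pow_three k o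
  circle := by
    rw [circlePerm]
    split_ifs
    · exact .inr rfl
    · exact .inl rfl
  -- From `cN` the circle passes under the top and then the bottom strand to `cS`, which belongs to
  -- the same arc as `cN` through the over-crossings on the left. Thus YXc = c, and X, Y are
  -- involutions.
  symmProd_circle := by
    have h₁ : linkArc k o .cS = act' (linkArc k o .botIn) (linkArc k o .cE) :=
      linkArc_under k o .botR 0 (by simp [overEven]) rfl
    rw [linkArc_cS, linkArc_cE] at h₁
    have hx := act'_linkArc_mul_self k o (e := .topIn) rfl
    have hy := act'_linkArc_mul_self k o (e := .botIn) rfl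
    have h₂ : act' (linkArc k o .botIn) (linkArc k o .cN) =
        act' (linkArc k o .topIn) (linkArc k o .cN) := by
      conv_lhs => rw [h₁]
      rw [← Equiv.Perm.mul_apply, hy, Equiv.Perm.one_apply]
    rw [symmProd, Equiv.Perm.mul_apply, h₂, ← Equiv.Perm.mul_apply, hx, Equiv.Perm.one_apply]
  clasp_top := by
    rw [← linkArc_a, ← linkArc_b, ← linkArc_claspR, ← linkArc_claspL]
    exact linkArc_under k o .claspTop 1 (by simp [overEven]) rfl
  clasp_bot := by
    rw [← linkArc_a, ← linkArc_claspL, ← linkArc_top_last]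
    exact linkArc_under k o .claspBot 1 (by simp [overEven]) rfl

theorem linkArc_eq_knotElement {e : Edge k.natAbs} (h : comp e = 0) : ∃ j s, linkArc k o e =
    knotElement (linkArc k o .topIn) (linkArc k o .botIn) (circlePerm k o) j s := by
  have ha : linkArc k o .a =
      knotElement (linkArc k o .topIn) (linkArc k o .botIn) (circlePerm k o) 1 0 := by
    rw [knotElement, zpow_one, dihedralSeq_zero, linkArc_a]
  cases e with
  | a => exact ⟨1, 0, ha⟩
  | b => exact ⟨1, 1, by rw [knotElement, zpow_one, dihedralSeq_one, linkArc_b]⟩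
  | topIn => exact ⟨0, 0, (dihedralSeq_zero _ (linkArc k o .botIn)).symm⟩
  | botIn => exact ⟨0, 1, (dihedralSeq_one (linkArc k o .topIn) _).symm⟩
  | claspL => exact ⟨0, _, linkArc_claspL k o⟩
  | claspR => exact ⟨1, 0, (linkArc_claspR k o).trans ha⟩
  | top j => exact ⟨0, _, (linkArc_strands k o j).1⟩
  | bot j => exact ⟨0, _, (linkArc_strands k o j).2⟩
  | cN | cW | cS | cE => exact absurd h (by simp [comp])

theorem linkArc_eq_circleElement {e : Edge k.natAbs} (h : comp e = 1) : ∃ b j, linkArc k o e =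
    circleElement (linkArc k o .topIn) (linkArc k o .cN) (circlePerm k o) b j := by
  cases e with
  | cN => exact ⟨false, 0, rfl⟩
  | cW => exact ⟨false, 0, linkArc_cW k o⟩
  | cS => exact ⟨false, 0, linkArc_cS k o⟩
  | cE => exact ⟨true, 0, linkArc_cE k o⟩
  | _ => exact absurd h (by simp [comp])

theorem comp_eq_zero_or_one (e : Edge k.natAbs) : comp e = 0 ∨ comp e = 1 := by
  generalize comp e = i
  revert i; decide

theorem innerGroup_le {H : Subgroup (Equiv.Perm ((twistLink k).NQuandle o ![2, 3]))}
    (hX : act' (linkArc k o .topIn) ∈ H)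
    (hR : symmProd (linkArc k o .topIn) (linkArc k o .botIn) ∈ H) (hZ : circlePerm k o ∈ H) :
    innerGroup ((twistLink k).NQuandle o ![2, 3]) ≤ H := by
  refine PresentedQuandle.innerGroup_le_of_generators fun e => ?_
  change act' (linkArc k o e) ∈ H
  rcases comp_eq_zero_or_one k e with h | h
  · obtain ⟨j, s, hs⟩ := linkArc_eq_knotElement k o h
    rw [hs]
    exact (twistRelations k o).act'_knotElement_mem hX hR hZ j s
  · obtain ⟨b, j, hj⟩ := linkArc_eq_circleElement k o h
    rw [hj]
    exact (twistRelations k o).act'_circleElement_mem hX hZ b j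

theorem quandleComponent_knot {e : Edge k.natAbs} (h : comp e = 0) :
    quandleComponent (linkArc k o e) = Set.range fun u => element k (linkArc k o .topIn)
      (linkArc k o .botIn) (linkArc k o .cN) (circlePerm k o) (.inl u) := by
  have hT := twistRelations k o
  obtain ⟨j, s, hs⟩ := linkArc_eq_knotElement k o h
  rw [hT.range_knotElement, ← hT.quandleComponent_knot fun H => innerGroup_le k o, hs]
  exact quandleComponent_eq_of_mem (hT.knotElement_mem_component j s)

theorem quandleComponent_circle {e : Edge k.natAbs} (h : comp e = 1) :
    quandleComponent (linkArc k o e) = Set.range fun u => element k (linkArc k o .topIn)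
      (linkArc k o .botIn) (linkArc k o .cN) (circlePerm k o) (.inr u) := by
  have hT := twistRelations k o
  obtain ⟨b, j, hj⟩ := linkArc_eq_circleElement k o h
  rw [range_circleElement, ← hT.quandleComponent_circle fun H => innerGroup_le k o, hj]
  exact quandleComponent_eq_of_mem (hT.circleElement_mem_component b j)

theorem element_surjective : Function.Surjective (element k (linkArc k o .topIn)
    (linkArc k o .botIn) (linkArc k o .cN) (circlePerm k o)) := by
  intro q
  obtain ⟨p, hp, e, rfl⟩ := PresentedQuandle.exists_inner_generator q
  have hq : p (linkArc k o e) ∈ quandleComponent (linkArc k o e) :=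
    mem_quandleComponent_iff.2 ⟨p, hp, rfl⟩
  rcases comp_eq_zero_or_one k e with h | h
  · rw [quandleComponent_knot k o h] at hq
    obtain ⟨u, hu⟩ := hq
    exact ⟨_, hu⟩
  · rw [quandleComponent_circle k o h] at hq
    obtain ⟨u, hu⟩ := hq
    exact ⟨_, hu⟩

end Arcs

end TwistLink

/-! ### The map to the model -/

namespace TwistModel

open DihedralGroup (r sr)

theorem seqImage_mul_self (k i : ℤ) : seqImage k i * seqImage k i = (quarter ^ 2, 1) := by
  refine Prod.ext ?_ (DihedralGroup.sr_mul_self _)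
  change quarter ^ (1 + 2 * i) * quarter ^ (1 + 2 * i) = _
  rw [← zpow_add, ← zpow_ofNat]
  exact quarter_zpow_congr (by omega)

/-- `quarter ^ 2` is -1. The images of the knot arcs have this square, so conjugation by them is an
involution although they have order 4. -/
theorem quarter_sq_mem_center (k : ℤ) (g : Model k) :
    (quarter ^ 2, 1) * g = g * (quarter ^ 2, 1) :=
  Prod.ext (quarter_sq_comm g.1) (by simp)

theorem seqImage_conj (k i j : ℤ) :
    seqImage k i * seqImage k j * (seqImage k i)⁻¹ = seqImage k (2 * i - j) := by
  refine Prod.ext ?_ ?_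
  · change quarter ^ (1 + 2 * i) * quarter ^ (1 + 2 * j) * (quarter ^ (1 + 2 * i))⁻¹ = _
    rw [← zpow_neg, ← zpow_add, ← zpow_add]
    exact quarter_zpow_congr (by omega)
  · simp [seqImage]
    ring

theorem eq_conj_comm {G : Type} [Group G] {g z : G} (hg : g * g = z) (hz : ∀ h, z * h = h * z)
    {a b : G} (h : a = g * b * g⁻¹) : b = g * a * g⁻¹ := by
  have : g * (g * b * g⁻¹) * g⁻¹ = g * g * b * (g * g)⁻¹ := by group
  rw [h, this, hg, hz, mul_inv_cancel_right]

/-- The image of the strand that leads from the circle to the clasp. -/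
def leftImage (k i : ℤ) : Model k := circleImage k * seqImage k i * (circleImage k)⁻¹

theorem leftImage_mul_self (k i : ℤ) : leftImage k i * leftImage k i = (quarter ^ 2, 1) := by
  have : leftImage k i * leftImage k i =
      circleImage k * (seqImage k i * seqImage k i) * (circleImage k)⁻¹ := by
    rw [leftImage]; group
  rw [this, seqImage_mul_self, ← quarter_sq_mem_center, mul_inv_cancel_right]

theorem oddClass_eq (k : ℤ) : oddClass k = 2 * (k : ZMod (3 * (2 * k - 1).natAbs)) - 1 := by
  simp [oddClass]

/-- In the dihedral factor, with w = 2k - 1, the two sides are the reflections with indices -2w and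
w, which agree because 3w = 0; this dictates the modulus 3|2k - 1|. In SL(2,3) only the parity of
`k` matters. -/
theorem leftImage_clasp_top (k : ℤ) :
    leftImage k 0 = seqImage k (1 - k) * leftImage k 1 * (seqImage k (1 - k))⁻¹ := by
  refine Prod.ext ?_ ?_
  · change third * quarter ^ (1 + 2 * (0 : ℤ)) * third⁻¹ = quarter ^ (1 + 2 * (1 - k)) *
      (third * quarter ^ (1 + 2 * (1 : ℤ)) * third⁻¹) * (quarter ^ (1 + 2 * (1 - k)))⁻¹
    rcases Int.even_or_odd' k with ⟨t, rfl | rfl⟩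
    · rw [quarter_zpow_congr (a := 1 + 2 * (1 - 2 * t)) (b := 3) (by omega)]
      decide
    · rw [quarter_zpow_congr (a := 1 + 2 * (1 - (2 * t + 1))) (b := 1) (by omega)]
      decide
  · have h := three_mul_eq_zero k
    simp [leftImage, seqImage, circleImage]
    rw [oddClass_eq] at *
    linear_combination (-1) * h

theorem leftImage_clasp_bot (k : ℤ) :
    seqImage k (-k) = leftImage k 0 * seqImage k (1 - k) * (leftImage k 0)⁻¹ := by
  refine Prod.ext ?_ ?_
  · change quarter ^ (1 + 2 * (-k)) = third * quarter ^ (1 + 2 * (0 : ℤ)) * third⁻¹ *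
      quarter ^ (1 + 2 * (1 - k)) * (third * quarter ^ (1 + 2 * (0 : ℤ)) * third⁻¹)⁻¹
    rcases Int.even_or_odd' k with ⟨t, rfl | rfl⟩
    · rw [quarter_zpow_congr (a := 1 + 2 * (1 - 2 * t)) (b := 3) (by omega),
        quarter_zpow_congr (a := 1 + 2 * (-(2 * t))) (b := 1) (by omega)]
      decide
    · rw [quarter_zpow_congr (a := 1 + 2 * (1 - (2 * t + 1))) (b := 1) (by omega),
        quarter_zpow_congr (a := 1 + 2 * (-(2 * t + 1))) (b := 3) (by omega)]
      decide
  · have h := three_mul_eq_zero k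
    simp [leftImage, seqImage, circleImage]
    rw [oddClass_eq] at *
    linear_combination h

theorem seqImage_conj_circleImage (k : ℤ) :
    circleImage k = seqImage k 1 * (seqImage k 0 * circleImage k * (seqImage k 0)⁻¹) *
      (seqImage k 1)⁻¹ := by
  refine Prod.ext ?_ ?_
  · change third = quarter ^ (1 + 2 * (1 : ℤ)) * (quarter ^ (1 + 2 * (0 : ℤ)) * third *
      (quarter ^ (1 + 2 * (0 : ℤ)))⁻¹) * (quarter ^ (1 + 2 * (1 : ℤ)))⁻¹
    decide
  · simp [seqImage, circleImage]

end TwistModel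

/-! ### The images of the edges satisfy the relations of the quandle. -/

namespace TwistLink

open Rack (act')
open TwistModel TwistRelations

section Image

variable (k : ℤ) (o : (twistLink k).Orientation)

/-- The image of the circle. -/
def orientedCircleImage : Model k :=
  if outAt k o .topL 1 then (circleImage k)⁻¹ else circleImage k

/-- The images of the edges in the model. -/
def edgeImage : Edge k.natAbs → Model k
  | .a | .claspR => leftImage k 0
  | .b => leftImage k 1
  | .topIn => seqImage k 0
  | .botIn => seqImage k 1
  | .cN | .cW | .cS => orientedCircleImage k o
  | .cE => seqImage k 0 * orientedCircleImage k o * (seqImage k 0)⁻¹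
  | .claspL => seqImage k (1 - k)
  | .top j => seqImage k (-(k.sign * j.val))
  | .bot j => seqImage k (1 - k.sign * j.val)

theorem edgeImage_top_last : edgeImage k o (.top (Fin.last _)) = seqImage k (-k) := by
  rw [edgeImage, Fin.val_last, Int.sign_mul_natAbs]

theorem edgeImage_bot_last : edgeImage k o (.bot (Fin.last _)) = seqImage k (1 - k) := by
  rw [edgeImage, Fin.val_last, Int.sign_mul_natAbs]

theorem edgeImage_top_zero : edgeImage k o (.top 0) = seqImage k 0 := by
  simp [edgeImage]

theorem edgeImage_bot_zero : edgeImage k o (.bot 0) = seqImage k 1 := by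
  simp [edgeImage]

theorem edgeImage_circle : orientedCircleImage k o = seqImage k 1 *
    (seqImage k 0 * orientedCircleImage k o * (seqImage k 0)⁻¹) * (seqImage k 1)⁻¹ := by
  have h := seqImage_conj_circleImage k
  rw [orientedCircleImage]
  split_ifs
  · conv_lhs => rw [h]
    group
  · exact h

theorem edgeImage_over {c : Crossing k.natAbs} {i : Fin 4}
    (h : i.val % 2 = 0 ↔ overEven (decide (0 < k)) c = true) :
    edgeImage k o (ends c i) = edgeImage k o (ends c (i + 2)) := by
  suffices H : (∀ i : Fin 4, i = 0 ∨ i = 1 → (i.val % 2 = 0 ↔ overEven (decide (0 < k)) c = true) →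
      edgeImage k o (ends c i) = edgeImage k o (ends c (i + 2))) by
    match i, h with
    | 0, h => exact H 0 (.inl rfl) h
    | 1, h => exact H 1 (.inr rfl) h
    | 2, h => exact (H 0 (.inl rfl) h).symm
    | 3, h => exact (H 1 (.inr rfl) h).symm
  rintro i hi h
  cases c with
  | topL | botL =>
    obtain rfl : i = 1 := by rcases hi with rfl | rfl <;> simp_all [overEven]
    rfl
  | topR =>
    obtain rfl : i = 0 := by rcases hi with rfl | rfl <;> simp_all [overEven]
    exact (edgeImage_top_zero k o).symm
  | botR =>
    obtain rfl : i = 0 := by rcases hi with rfl | rfl <;> simp_all [overEven]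
    exact (edgeImage_bot_zero k o).symm
  | claspTop =>
    obtain rfl : i = 1 := by rcases hi with rfl | rfl <;> simp_all [overEven]
    exact (edgeImage_bot_last k o).symm
  | claspBot =>
    obtain rfl : i = 1 := by rcases hi with rfl | rfl <;> simp_all [overEven]
    rfl
  | twist j =>
    have hj := j.isLt
    rcases hi with rfl | rfl
    · have hk : 0 < k := by simpa [overEven] using h
      change seqImage k (-(k.sign * j.castSucc.val)) = seqImage k (1 - k.sign * j.succ.val)
      rw [Int.sign_eq_one_of_pos hk, Fin.val_castSucc, Fin.val_succ]
      congr 1; push_cast; ring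
    · have hk : ¬ 0 < k := by simpa [overEven] using h
      change seqImage k (1 - k.sign * j.castSucc.val) = seqImage k (-(k.sign * j.succ.val))
      rw [Int.sign_eq_neg_one_of_neg (by omega), Fin.val_castSucc, Fin.val_succ]
      congr 1; push_cast; ring

theorem edgeImage_under_circle {c : Crossing k.natAbs} (hc : c = .topL ∨ c = .botL) {i : Fin 4}
    (h : i.val % 2 = 0 ↔ overEven (decide (0 < k)) c = true) (h' : outAt k o c i = true) :
    edgeImage k o (ends c (i + 1)) = edgeImage k o (ends c i) * edgeImage k o (ends c (i + 3)) *
      (edgeImage k o (ends c i))⁻¹ := by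
  have hout : outAt k o c 1 = outAt k o .topL 1 := by
    rcases hc with rfl | rfl
    · rfl
    · exact outAt_botL k o
  have h₃ : outAt k o c 3 = _ := outAt_add_two k o c 1
  rw [hout] at h₃
  have hi : i = 1 ∨ i = 3 := by
    rcases hc with rfl | rfl
    · exact eq_one_or_three h
    · exact eq_one_or_three h
  rcases hi with rfl | rfl
  · have hγ : orientedCircleImage k o = (circleImage k)⁻¹ := if_pos (hout.symm.trans h')
    have key : ∀ i, seqImage k i =
        orientedCircleImage k o * leftImage k i * (orientedCircleImage k o)⁻¹ := by
      intro i
      rw [hγ, leftImage]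
      group
    rcases hc with rfl | rfl
    · exact key 0
    · exact key 1
  · have hγ : orientedCircleImage k o = circleImage k := if_neg (by
      rw [h'] at h₃
      simpa using h₃.symm)
    have key : ∀ i, leftImage k i =
        orientedCircleImage k o * seqImage k i * (orientedCircleImage k o)⁻¹ := by
      intro i
      rw [hγ, leftImage]
    rcases hc with rfl | rfl
    · exact key 0
    · exact key 1

theorem edgeImage_sq {e : Edge k.natAbs} (h : comp e = 0) :
    edgeImage k o e * edgeImage k o e = (quarter ^ 2, 1) := by
  cases e with
  | a | claspR | b => exact leftImage_mul_self k _
  | cN | cW | cS | cE => exact absurd h (by simp [comp])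
  | _ => exact seqImage_mul_self k _

theorem edgeImage_cube {e : Edge k.natAbs} (h : comp e = 1) : edgeImage k o e ^ 3 = 1 := by
  have hγ : orientedCircleImage k o ^ 3 = 1 := by
    rw [orientedCircleImage]
    split_ifs
    · rw [inv_pow, circleImage_pow_three, inv_one]
    · exact circleImage_pow_three k
  cases e with
  | cN | cW | cS => exact hγ
  | cE =>
    rw [edgeImage, conj_pow, hγ, mul_one, mul_inv_cancel]
  | _ => exact absurd h (by simp [comp])

theorem edgeImage_under_knot {c : Crossing k.natAbs} (hc : c ≠ .topL ∧ c ≠ .botL) {i : Fin 4}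
    (h : i.val % 2 = 0 ↔ overEven (decide (0 < k)) c = true) :
    edgeImage k o (ends c (i + 1)) = edgeImage k o (ends c i) * edgeImage k o (ends c (i + 3)) *
      (edgeImage k o (ends c i))⁻¹ := by
  have hcomp : comp (ends c i) = 0 := by
    cases c with
    | topL => exact absurd rfl hc.1
    | botL => exact absurd rfl hc.2
    | topR | botR => rcases eq_zero_or_two h with rfl | rfl <;> rfl
    | twist | claspTop | claspBot => fin_cases i <;> rfl
  suffices H : (∀ i : Fin 4, i = 0 ∨ i = 1 → (i.val % 2 = 0 ↔ overEven (decide (0 < k)) c = true) →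
      edgeImage k o (ends c (i + 1)) = edgeImage k o (ends c i) * edgeImage k o (ends c (i + 3)) *
      (edgeImage k o (ends c i))⁻¹) by
    -- At the ends 2 and 3 the under-edges are exchanged; since the over-image has central square,
    -- the relation is equivalent to that at the opposite end.
    have hsq := edgeImage_sq k o hcomp
    match i, h with
    | 0, h => exact H 0 (.inl rfl) h
    | 1, h => exact H 1 (.inr rfl) h
    | 2, h =>
      have h₁ := H 0 (.inl rfl) h
      rw [edgeImage_over k o (i := 0) h] at h₁
      exact eq_conj_comm hsq (quarter_sq_mem_center k) h₁
    | 3, h =>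
      have h₁ := H 1 (.inr rfl) h
      rw [edgeImage_over k o (i := 1) h] at h₁
      exact eq_conj_comm hsq (quarter_sq_mem_center k) h₁
  rintro i hi h
  cases c with
  | topL => exact absurd rfl hc.1
  | botL => exact absurd rfl hc.2
  | topR =>
    obtain rfl : i = 0 := by rcases hi with rfl | rfl <;> simp_all [overEven]
    rfl
  | botR =>
    obtain rfl : i = 0 := by rcases hi with rfl | rfl <;> simp_all [overEven]
    exact edgeImage_circle k o
  | claspTop =>
    obtain rfl : i = 1 := by rcases hi with rfl | rfl <;> simp_all [overEven]
    exact leftImage_clasp_top k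
  | claspBot =>
    obtain rfl : i = 1 := by rcases hi with rfl | rfl <;> simp_all [overEven]
    exact (edgeImage_top_last k o).trans (leftImage_clasp_bot k)
  | twist j =>
    have hj := j.isLt
    rcases hi with rfl | rfl
    · have hk : 0 < k := by simpa [overEven] using h
      change seqImage k (1 - k.sign * j.castSucc.val) = seqImage k (-(k.sign * j.castSucc.val)) *
        seqImage k (-(k.sign * j.succ.val)) * (seqImage k (-(k.sign * j.castSucc.val)))⁻¹
      rw [seqImage_conj, Int.sign_eq_one_of_pos hk, Fin.val_castSucc, Fin.val_succ]
      congr 1; push_cast; ring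
    · have hk : ¬ 0 < k := by simpa [overEven] using h
      change seqImage k (1 - k.sign * j.succ.val) = seqImage k (1 - k.sign * j.castSucc.val) *
        seqImage k (-(k.sign * j.castSucc.val)) * (seqImage k (1 - k.sign * j.castSucc.val))⁻¹
      rw [seqImage_conj, Int.sign_eq_neg_one_of_neg (by omega), Fin.val_castSucc, Fin.val_succ]
      congr 1; push_cast; ring

theorem evalConj_edgeImage {s t : QTerm (twistLink k).Edge}
    (h : LinkDiagram.NWirtingerRel (twistLink k) o ![2, 3] s t) :
    PresentedQuandle.evalConj (edgeImage k o) s = PresentedQuandle.evalConj (edgeImage k o) t := by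
  rcases h with h | ⟨e, e'⟩
  · rcases h with ⟨c, i, h⟩ | ⟨c, i, h, h'⟩
    · exact edgeImage_over k o h
    · by_cases hc : c = Crossing.topL ∨ c = Crossing.botL
      · exact edgeImage_under_circle k o hc h h'
      · exact edgeImage_under_knot k o (not_or.1 hc) h
  · refine (PresentedQuandle.evalConj_iterate_rhd _ _ _ _).trans ?_
    change edgeImage k o e' ^ ![2, 3] (comp e') * edgeImage k o e *
      (edgeImage k o e' ^ ![2, 3] (comp e'))⁻¹ = edgeImage k o e
    rcases comp_eq_zero_or_one k e' with h | h
    · rw [h]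
      change edgeImage k o e' ^ 2 * _ * (edgeImage k o e' ^ 2)⁻¹ = _
      rw [pow_two, edgeImage_sq k o h, quarter_sq_mem_center, mul_inv_cancel_right]
    · rw [h]
      change edgeImage k o e' ^ 3 * _ * (edgeImage k o e' ^ 3)⁻¹ = _
      rw [edgeImage_cube k o h, one_mul, inv_one, mul_one]

/-- The homomorphism from the fundamental `(2, 3)`-quandle to the conjugation quandle of the
model. -/
def toModel : (twistLink k).NQuandle o ![2, 3] → Model k :=
  PresentedQuandle.liftConj (edgeImage k o) fun _ _ h => evalConj_edgeImage k o h

theorem toModel_linkArc (e : Edge k.natAbs) : toModel k o (linkArc k o e) = edgeImage k o e := rfl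

theorem toModel_act' (a b : (twistLink k).NQuandle o ![2, 3]) :
    toModel k o (act' a b) = toModel k o a * toModel k o b * (toModel k o a)⁻¹ :=
  PresentedQuandle.liftConj_act' _ _ a b

/-- Both the permutation and the image of the circle are inverted when the circle is reversed, so Z
corresponds to the same model element for every orientation. -/
theorem circlePerm_mem_intertwiners :
    (circlePerm k o, circleImage k) ∈ intertwiners (toModel k o) := by
  have h : (act' (linkArc k o .cN), orientedCircleImage k o) ∈ intertwiners (toModel k o) :=
    fun q => toModel_act' k o _ q
  rw [orientedCircleImage] at h
  rw [circlePerm]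
  split_ifs at h ⊢
  · have h₁ := inv_mem h
    rwa [Prod.inv_mk, inv_inv] at h₁
  · exact h

theorem element_bijective : Function.Bijective (element k (linkArc k o .topIn)
    (linkArc k o .botIn) (linkArc k o .cN) (circlePerm k o)) := by
  refine ⟨element_injective (φ := toModel k o) (toModel_act' k o) (toModel_linkArc k o .topIn)
    (toModel_linkArc k o .botIn) (circlePerm_mem_intertwiners k o) ?_, element_surjective k o⟩
  rw [toModel_linkArc, edgeImage, orientedCircleImage]
  split_ifs
  · exact .inr rfl
  · exact .inl rfl

end Image

end TwistLink

theorem theorem2 (k : ℤ) (o : (twistLink k).Orientation) :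
    (Nat.card ((twistLink k).NQuandle o ![2, 3]) : ℤ) = 18 * |2 * k - 1| + 8 ∧
    (∀ e, (twistLink k).comp e = 0 →
      (Nat.card (quandleComponent ((twistLink k).arc o ![2, 3] e)) : ℤ) = 18 * |2 * k - 1|) ∧
    (∀ e, (twistLink k).comp e = 1 →
      Nat.card (quandleComponent ((twistLink k).arc o ![2, 3] e)) = 8) := by
  have hb := TwistLink.element_bijective k o
  refine ⟨?_, fun e he => ?_, fun e he => ?_⟩
  · rw [← Nat.card_eq_of_bijective _ hb]
    simp [Nat.card_eq_fintype_card]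
    ring
  · change (Nat.card (quandleComponent (TwistLink.linkArc k o e)) : ℤ) = _
    rw [TwistLink.quandleComponent_knot k o he]
    refine (congrArg Nat.cast (Nat.card_range_of_injective
      (hb.injective.comp Sum.inl_injective))).trans ?_
    simp [Nat.card_eq_fintype_card]
    ring
  · change Nat.card (quandleComponent (TwistLink.linkArc k o e)) = _
    rw [TwistLink.quandleComponent_circle k o he]
    refine (Nat.card_range_of_injective (hb.injective.comp Sum.inr_injective)).trans ?_
    simp [Nat.card_eq_fintype_card]
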